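/- Let $(M,\varphi,\xi,\eta,g)$ be a (connected, smooth) three-dimensional almost paracontact metric manifold: $\varphi$ is a $(1,1)$-tensor, $\xi$ a vector field, $\eta$ a $1$-form with $\varphi\xi=0$, $\eta\circ\varphi=0$, $\eta(\xi)=1$, $\varphi^2=\mathrm{Id}-\eta\otimes\xi$, the $(\pm1)$-eigendistributions of $\varphi|_{\ker\eta}$ have equal dimension, and $g$ is a pseudo-Riemannian metric with $g(\varphi X,\varphi Y)=-g(X,Y)+\eta(X)\eta(Y)$. Assume that the structure is normal, $[\varphi,\varphi]-2\,d\eta\otimes\xi=0$ (with $2\,d\eta(X,Y)=X\eta(Y)-Y\eta(X)-\eta([X,Y])$), and that it is an almost paracontact Ricci soliton, i.e. for some real number $\lambda$ $$\mathcal L_\xi g+\varrho=\lambda g ,$$ where $\varrho$ is the Ricci tensor of $g$. Let $r$ denote the scalar curvature. A local $\varphi$-basis is a smooth pseudo-orthonormal basis $\{\xi,e,\varphi e\}$ of vector fields on an open set, with $\xi,e$ space-like and $\varphi e$ time-like. Around every point of $M$ there are a local $\varphi$-basis $\{\xi,e,\varphi e\}$ and smooth functions $b_1,b_2,a_3,a_4,a_5$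 with $$[\xi,e]=-b_1e+(a_3-b_2)\varphi e,\qquad [\xi,\varphi e]=(a_3-b_2)e-b_1\varphi e,\qquad [e,\varphi e]=2b_2\xi+a_4e-a_5\varphi e. \tag{$*$}$$ Whenever $(*)$ holds for a $\varphi$-basis and smooth functions $b_1,b_2,a_3,a_4,a_5$ on an open set $U$, one has on $U$ $$\xi(b_2)+2b_1b_2=0,\qquad -\xi(a_4)+e(a_3-b_2)+\varphi e(b_1)-b_1a_4+a_5(a_3-b_2)=0,$$ $$\xi(a_5)-e(b_1)-\varphi e(a_3-b_2)+b_1a_5-a_4(a_3-b_2)=0,\qquad \xi(b_1)+2b_1^2=0.$$ Moreover: 1) If $\lambda\neq0$ (unsteady case), then $\xi$ is a Killing vector field and $(M,g)$ has constant sectional curvature $k<0$, where $k=-b_2^2$ for every local description $(*)$. 2) If $\lambda=0$ (steady case), then for every local description $(*)$ on an open set $U$, each point of $U$ has a neighbourhood on which, for a constant $\varepsilon\in\{1,-1\}$, $$b_2=\varepsilon b_1,\qquad \xi(b_1)=-2b_1^2,\qquad r=-4b_1,\qquad (e-\varepsilon\,\varphi e)(b_1)=0.$$ -/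

import Mathlib

open scoped Manifold ContDiff
open Bundle

noncomputable section

namespace Paracontact

/-- The model space `ℝⁿ`. -/
abbrev Model (n : ℕ) : Type := EuclideanSpace ℝ (Fin n)

section General

variable {n : ℕ} {M : Type*} [TopologicalSpace M] [ChartedSpace (Model n) M]

/-- (Not necessarily continuous) vector fields on the `n`-manifold `M`. -/
abbrev VField (n : ℕ) (M : Type*) [TopologicalSpace M] [ChartedSpace (Model n) M] : Type _ :=
  ∀ p : M, TangentSpace (𝓡 n) p

/-- Directional derivative `v(f)` of a function `f` along a tangent vector `v` at `p`. -/
def dirDeriv (f : M → ℝ) (p : M) (v : TangentSpace (𝓡 n) p) : ℝ :=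
  mvfderiv (𝓡 n) f p v

/-- The Lie bracket `[X, Y]` of vector fields. -/
def bracket (X Y : VField n M) : VField n M :=
  fun p => VectorField.mlieBracket (𝓡 n) X Y p

/-- An extension of the tangent vector `v` at `p` to a vector field that is smooth near `p`. -/
def extendVec {p : M} [IsManifold (𝓡 n) ∞ M] (v : TangentSpace (𝓡 n) p) : VField n M :=
  FiberBundle.extend (Model n) v

/-- The standard basis of the tangent space (that is, of the model space `ℝⁿ`). -/
def tangentBasis (p : M) : Module.Basis (Fin n) ℝ (TangentSpace (𝓡 n) p) :=
  (EuclideanSpace.basisFun (Fin n) ℝ).toBasis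

variable [IsManifold (𝓡 n) ∞ M]

/-- The vector field `X` is smooth on the set `U`. -/
def SmoothFieldOn (X : VField n M) (U : Set M) : Prop :=
  ContMDiffOn (𝓡 n) ((𝓡 n).prod 𝓘(ℝ, Model n)) ∞
    (fun p => (TotalSpace.mk' (Model n) p (X p) : TangentBundle (𝓡 n) M)) U

/-- The vector field `X` is smooth at the point `p`. -/
def SmoothFieldAt (X : VField n M) (p : M) : Prop :=
  ContMDiffAt (𝓡 n) ((𝓡 n).prod 𝓘(ℝ, Model n)) ∞
    (fun q => (TotalSpace.mk' (Model n) q (X q) : TangentBundle (𝓡 n) M)) p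

/-- A smooth pseudo-Riemannian metric (of arbitrary signature) on the `n`-manifold `M`. -/
structure PseudoMetric (n : ℕ) (M : Type*) [TopologicalSpace M] [ChartedSpace (Model n) M]
    [IsManifold (𝓡 n) ∞ M] where
  /-- The scalar products on the tangent spaces. -/
  val : ∀ p : M, TangentSpace (𝓡 n) p →L[ℝ] TangentSpace (𝓡 n) p →L[ℝ] ℝ
  symm : ∀ (p : M) (u v : TangentSpace (𝓡 n) p), val p u v = val p v u
  nondegenerate : ∀ (p : M) (u : TangentSpace (𝓡 n) p), (∀ v, val p u v = 0) → u = 0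
  smooth :
    ContMDiff (𝓡 n) ((𝓡 n).prod 𝓘(ℝ, Model n →L[ℝ] Model n →L[ℝ] ℝ)) ∞
      (fun p => TotalSpace.mk' (Model n →L[ℝ] Model n →L[ℝ] ℝ)
        (E := fun p : M => TangentSpace (𝓡 n) p →L[ℝ] TangentSpace (𝓡 n) p →L[ℝ] ℝ) p (val p))

namespace PseudoMetric

variable (g : PseudoMetric n M)

/-- The metric at `p` as a bilinear form. -/
def form (p : M) : LinearMap.BilinForm ℝ (TangentSpace (𝓡 n) p) :=
  LinearMap.mk₂ ℝ (fun u v => g.val p u v) (by simp) (by simp) (by simp) (by simp)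

theorem form_nondegenerate (p : M) : (g.form p).Nondegenerate :=
  ⟨fun u hu => g.nondegenerate p u hu,
    fun u hu => g.nondegenerate p u fun v => (g.symm p u v).trans (hu v)⟩

/-- The basis of the tangent space at `p` that is `g`-dual to the standard one:
`g (dualBasis i) (tangentBasis j) = δᵢⱼ`. -/
def dualBasis (p : M) : Module.Basis (Fin n) ℝ (TangentSpace (𝓡 n) p) :=
  (g.form p).dualBasis (g.form_nondegenerate p) (tangentBasis p)

/-- The right-hand side of the Koszul formula for `2 g(∇_X Y, Z)`. -/
def koszul (X Y Z : VField n M) (p : M) : ℝ :=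
  dirDeriv (fun q => g.val q (Y q) (Z q)) p (X p)
    + dirDeriv (fun q => g.val q (Z q) (X q)) p (Y p)
    - dirDeriv (fun q => g.val q (X q) (Y q)) p (Z p)
    + g.val p (bracket X Y p) (Z p)
    - g.val p (bracket X Z p) (Y p)
    - g.val p (bracket Y Z p) (X p)

/-- The Levi-Civita connection: `∇_X Y` at `p` is the tangent vector `w` such that `g(w, v)` is
half of the Koszul expression in `X`, `Y`, `v`, for all tangent vectors `v` at `p`. -/
def nabla (X Y : VField n M) : VField n M := fun p =>
  ∑ i, (g.koszul X Y (extendVec (tangentBasis p i)) p / 2) • g.dualBasis p i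

/-- The curvature `R(X, Y) Z = ∇_{[X, Y]} Z - [∇_X, ∇_Y] Z` (note the sign convention). -/
def curvature (X Y Z : VField n M) : VField n M := fun p =>
  g.nabla (bracket X Y) Z p - (g.nabla X (g.nabla Y Z) p - g.nabla Y (g.nabla X Z) p)

/-- The value `R(u, v) w` of the curvature tensor on tangent vectors at `p`. -/
def curvatureAt (p : M) (u v w : TangentSpace (𝓡 n) p) : TangentSpace (𝓡 n) p :=
  g.curvature (extendVec u) (extendVec v) (extendVec w) p

/-- The Ricci tensor `ϱ(u, v)`, the trace of `x ↦ R(u, x) v` (with the above sign of `R`, this is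
the usual Ricci tensor, positive on round spheres). -/
def ricci (p : M) (u v : TangentSpace (𝓡 n) p) : ℝ :=
  ∑ i, (tangentBasis p).coord i (g.curvatureAt p u (tangentBasis p i) v)

/-- The scalar curvature `r`, the trace of the Ricci tensor with respect to `g`. -/
def scalar (p : M) : ℝ :=
  ∑ i, g.ricci p (tangentBasis p i) (g.dualBasis p i)

/-- The sectional curvature of the plane spanned by `u` and `v`. -/
def sectional (p : M) (u v : TangentSpace (𝓡 n) p) : ℝ :=
  g.val p (g.curvatureAt p u v u) v / (g.val p u u * g.val p v v - g.val p u v ^ 2)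

/-- All nondegenerate tangent planes have sectional curvature `k`. -/
def HasConstantSectionalCurvature (k : ℝ) : Prop :=
  ∀ (p : M) (u v : TangentSpace (𝓡 n) p),
    g.val p u u * g.val p v v - g.val p u v ^ 2 ≠ 0 → g.sectional p u v = k

/-- `(L_X g)(Y, Z) = X g(Y, Z) - g([X, Y], Z) - g(Y, [X, Z])`. -/
def lieDeriv (X Y Z : VField n M) (p : M) : ℝ :=
  dirDeriv (fun q => g.val q (Y q) (Z q)) p (X p)
    - g.val p (bracket X Y p) (Z p) - g.val p (Y p) (bracket X Z p)

/-- `X` is a Killing vector field: `L_X g = 0`. -/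
def IsKilling (X : VField n M) : Prop :=
  ∀ (p : M) (Y Z : VField n M), SmoothFieldAt Y p → SmoothFieldAt Z p → g.lieDeriv X Y Z p = 0

/-- The Ricci soliton equation `L_X g + ϱ = c g` for the vector field `X` and the constant `c`. -/
def IsRicciSoliton (X : VField n M) (c : ℝ) : Prop :=
  ∀ (p : M) (Y Z : VField n M), SmoothFieldAt Y p → SmoothFieldAt Z p →
    g.lieDeriv X Y Z p + g.ricci p (Y p) (Z p) = c * g.val p (Y p) (Z p)

end PseudoMetric

end General

/-- An almost paracontact metric structure `(φ, ξ, η, g)` on a `3`-manifold. -/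
structure AlmostParacontactMetric (M : Type*) [TopologicalSpace M] [ChartedSpace (Model 3) M]
    [IsManifold (𝓡 3) ∞ M] where
  phi : ∀ p : M, TangentSpace (𝓡 3) p →L[ℝ] TangentSpace (𝓡 3) p
  xi : VField 3 M
  eta : ∀ p : M, TangentSpace (𝓡 3) p →L[ℝ] ℝ
  g : PseudoMetric 3 M
  phi_smooth :
    ContMDiff (𝓡 3) ((𝓡 3).prod 𝓘(ℝ, Model 3 →L[ℝ] Model 3)) ∞
      (fun p => TotalSpace.mk' (Model 3 →L[ℝ] Model 3)
        (E := fun p : M => TangentSpace (𝓡 3) p →L[ℝ] TangentSpace (𝓡 3) p) p (phi p))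
  xi_smooth : SmoothFieldOn xi Set.univ
  eta_smooth :
    ContMDiff (𝓡 3) ((𝓡 3).prod 𝓘(ℝ, Model 3 →L[ℝ] ℝ)) ∞
      (fun p => TotalSpace.mk' (Model 3 →L[ℝ] ℝ)
        (E := fun p : M => TangentSpace (𝓡 3) p →L[ℝ] ℝ) p (eta p))
  phi_xi : ∀ p, phi p (xi p) = 0
  eta_phi : ∀ p v, eta p (phi p v) = 0
  eta_xi : ∀ p, eta p (xi p) = 1
  phi_sq : ∀ p v, phi p (phi p v) = v - eta p v • xi p
  /-- The eigendistributions of `φ` on `ker η` for the eigenvalues `1` and `-1` have the same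
  dimension. -/
  paracomplex : ∀ p : M,
    Module.finrank ℝ ↥((eta p).toLinearMap.ker ⊓
        Module.End.eigenspace (phi p).toLinearMap (1 : ℝ)) =
      Module.finrank ℝ ↥((eta p).toLinearMap.ker ⊓
        Module.End.eigenspace (phi p).toLinearMap (-1 : ℝ))
  compatible : ∀ p u v, g.val p (phi p u) (phi p v) = -g.val p u v + eta p u * eta p v

namespace AlmostParacontactMetric

variable {M : Type*} [TopologicalSpace M] [ChartedSpace (Model 3) M] [IsManifold (𝓡 3) ∞ M]
  (S : AlmostParacontactMetric M)

/-- The vector field `φ X`. -/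
def phiField (X : VField 3 M) : VField 3 M := fun p => S.phi p (X p)

/-- The Nijenhuis torsion
`[φ, φ](X, Y) = φ²[X, Y] + [φX, φY] - φ[φX, Y] - φ[X, φY]`. -/
def nijenhuis (X Y : VField 3 M) : VField 3 M := fun p =>
  S.phi p (S.phi p (bracket X Y p)) + bracket (S.phiField X) (S.phiField Y) p
    - S.phi p (bracket (S.phiField X) Y p) - S.phi p (bracket X (S.phiField Y) p)

/-- The exterior derivative, normalised by `2 dη(X, Y) = X η(Y) - Y η(X) - η([X, Y])`. -/
def dEta (X Y : VField 3 M) (p : M) : ℝ :=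
  (dirDeriv (fun q => S.eta q (Y q)) p (X p) - dirDeriv (fun q => S.eta q (X q)) p (Y p)
    - S.eta p (bracket X Y p)) / 2

/-- The structure is normal: `[φ, φ] - 2 dη ⊗ ξ = 0`. -/
def IsNormal : Prop :=
  ∀ (p : M) (X Y : VField 3 M), SmoothFieldAt X p → SmoothFieldAt Y p →
    S.nijenhuis X Y p - (2 * S.dEta X Y p) • S.xi p = 0

/-- `{ξ, e, φe}` is a smooth `φ`-basis on `U`: it is pseudo-orthonormal with `ξ`, `e` space-like and
`φe` time-like. -/
structure IsPhiBasis (e : VField 3 M) (U : Set M) : Prop where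
  smooth : SmoothFieldOn e U
  xi_xi : ∀ p ∈ U, S.g.val p (S.xi p) (S.xi p) = 1
  e_e : ∀ p ∈ U, S.g.val p (e p) (e p) = 1
  phi_phi : ∀ p ∈ U, S.g.val p (S.phi p (e p)) (S.phi p (e p)) = -1
  xi_e : ∀ p ∈ U, S.g.val p (S.xi p) (e p) = 0
  xi_phi : ∀ p ∈ U, S.g.val p (S.xi p) (S.phi p (e p)) = 0
  e_phi : ∀ p ∈ U, S.g.val p (e p) (S.phi p (e p)) = 0

/-- The Lie brackets of the `φ`-basis `{ξ, e, φe}` on the open set `U` are given by the smooth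
functions `b₁, b₂, a₃, a₄, a₅` on `U`:
`[ξ, e] = -b₁ e + (a₃ - b₂) φe`, `[ξ, φe] = (a₃ - b₂) e - b₁ φe`,
`[e, φe] = 2 b₂ ξ + a₄ e - a₅ φe`. -/
structure IsLocalDescription (U : Set M) (e : VField 3 M) (b₁ b₂ a₃ a₄ a₅ : M → ℝ) : Prop where
  isOpen : IsOpen U
  phiBasis : S.IsPhiBasis e U
  smooth_b₁ : ContMDiffOn (𝓡 3) 𝓘(ℝ, ℝ) ∞ b₁ U
  smooth_b₂ : ContMDiffOn (𝓡 3) 𝓘(ℝ, ℝ) ∞ b₂ U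
  smooth_a₃ : ContMDiffOn (𝓡 3) 𝓘(ℝ, ℝ) ∞ a₃ U
  smooth_a₄ : ContMDiffOn (𝓡 3) 𝓘(ℝ, ℝ) ∞ a₄ U
  smooth_a₅ : ContMDiffOn (𝓡 3) 𝓘(ℝ, ℝ) ∞ a₅ U
  xi_e : ∀ p ∈ U, bracket S.xi e p = -b₁ p • e p + (a₃ p - b₂ p) • S.phi p (e p)
  xi_phi : ∀ p ∈ U,
    bracket S.xi (S.phiField e) p = (a₃ p - b₂ p) • e p - b₁ p • S.phi p (e p)
  e_phi : ∀ p ∈ U,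
    bracket e (S.phiField e) p = (2 * b₂ p) • S.xi p + a₄ p • e p - a₅ p • S.phi p (e p)

/-- The identities satisfied on `U` by the functions in the bracket relations of a `φ`-basis
(equivalent to the Jacobi identity). -/
def JacobiEquations (U : Set M) (e : VField 3 M) (b₁ b₂ a₃ a₄ a₅ : M → ℝ) : Prop :=
  ∀ p ∈ U,
    dirDeriv b₂ p (S.xi p) + 2 * b₁ p * b₂ p = 0 ∧
    -dirDeriv a₄ p (S.xi p) + dirDeriv (fun q => a₃ q - b₂ q) p (e p)
      + dirDeriv b₁ p (S.phi p (e p)) - b₁ p * a₄ p + a₅ p * (a₃ p - b₂ p) = 0 ∧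
    dirDeriv a₅ p (S.xi p) - dirDeriv b₁ p (e p)
      - dirDeriv (fun q => a₃ q - b₂ q) p (S.phi p (e p)) + b₁ p * a₅ p
      - a₄ p * (a₃ p - b₂ p) = 0

end AlmostParacontactMetric

end Paracontact

end

open Paracontact

/-! The computation takes place in a local frame ξ, e, φe. Normality says that L_ξ preserves ker η
and commutes with φ there (`bracket_xi_of_isNormal`); this forces the bracket relations. Koszul's
formula then expresses the connection, the curvature and the Ricci tensor through b₁, b₂, a₃, a₄, a₅
and their first derivatives (`nabla_frame`, `ricci_frame`), and the Jacobi identity of the frame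
gives three of the four differential identities (`jacobiEquations`).

On the frame L_ξ g = 2b₁(g − η⊗η), so the soliton equation with constant c yields ξ(b₁) + b₁² + b₂²
= −c/2, e(b₁) = φe(b₂), e(b₂) = φe(b₁), one equation for the horizontal curvature, and r = 3c − 4b₁.
Differentiating the horizontal equation along ξ and removing all second derivatives is a contracted
Bianchi identity in disguise; it gives the fourth identity ξ(b₁) = −2b₁² (`xi_b₁_add`). Together
with the first equation, b₁² − b₂² = c/2. Differentiating this along ξ, with ξ(b₂) = −2b₁b₂, gives c
b₁ = 0 (`b₁_mul_eq_zero`).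

If c ≠ 0, then b₁ = 0, so ξ is Killing, the metric is Einstein, b₂² = −c/2, and the curvature is
constant, equal to c/2 = −b₂² (`curvatureAt_eq_of_ne_zero`).

If c = 0, then (b₁ + b₂)(b₁ − b₂) = 0 pointwise, and the difficulty is to make one factor vanish on
a whole neighbourhood. The factor u = b₁ + b₂ is constant along e − φe; v = b₁ − b₂ is constant
along e + φe and satisfies ξ(v) = −2b₁v. Hence u ≠ 0 propagates along curves tangent to e − φe, and
v ≠ 0 along curves tangent to the span of e + φe and ξ. Were both factors nonzero at points
arbitrarily near p, two such curves could be made to meet (`eventually_eq_zero_or_of_mul_eq_zero`),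
and uv would not vanish there. -/

namespace Paracontact

/-! ### Directional derivatives and Lie brackets of smooth fields -/

section Calculus

variable {n : ℕ} {M : Type*} [TopologicalSpace M] [ChartedSpace (Model n) M]

/-- The function `f` is smooth at the point `p`. -/
abbrev SmoothFnAt (f : M → ℝ) (p : M) : Prop := ContMDiffAt (𝓡 n) 𝓘(ℝ, ℝ) ∞ f p

theorem SmoothFnAt.mdiff {f : M → ℝ} {p : M} (hf : SmoothFnAt (n := n) f p) :
    MDifferentiableAt (𝓡 n) 𝓘(ℝ, ℝ) f p :=
  hf.mdifferentiableAt (by simp)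

theorem dirDeriv_congr {f h : M → ℝ} {p : M} (hfh : f =ᶠ[nhds p] h)
    (v : TangentSpace (𝓡 n) p) : dirDeriv f p v = dirDeriv h p v :=
  congrArg (fun L : Model n →L[ℝ] ℝ => L v) (hfh.mfderiv_eq (I := 𝓡 n) (I' := 𝓘(ℝ, ℝ)))

@[simp] theorem dirDeriv_const (c : ℝ) (p : M) (v : TangentSpace (𝓡 n) p) :
    dirDeriv (fun _ : M => c) p v = 0 := by
  simp [dirDeriv, mvfderiv_const]

theorem dirDeriv_add {f h : M → ℝ} {p : M} (hf : SmoothFnAt (n := n) f p)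
    (hh : SmoothFnAt (n := n) h p) (v : TangentSpace (𝓡 n) p) :
    dirDeriv (fun q => f q + h q) p v = dirDeriv f p v + dirDeriv h p v := by
  simp [dirDeriv, mvfderiv_fun_add hf.mdiff hh.mdiff]

theorem dirDeriv_sub {f h : M → ℝ} {p : M} (hf : SmoothFnAt (n := n) f p)
    (hh : SmoothFnAt (n := n) h p) (v : TangentSpace (𝓡 n) p) :
    dirDeriv (fun q => f q - h q) p v = dirDeriv f p v - dirDeriv h p v := by
  simp [dirDeriv, mvfderiv_fun_sub hf.mdiff hh.mdiff]

theorem dirDeriv_neg {f : M → ℝ} {p : M} (v : TangentSpace (𝓡 n) p) :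
    dirDeriv (fun q => -f q) p v = -dirDeriv f p v := by
  simp [dirDeriv, mvfderiv_fun_neg]

theorem dirDeriv_mul {f h : M → ℝ} {p : M} (hf : SmoothFnAt (n := n) f p)
    (hh : SmoothFnAt (n := n) h p) (v : TangentSpace (𝓡 n) p) :
    dirDeriv (fun q => f q * h q) p v = f p * dirDeriv h p v + h p * dirDeriv f p v := by
  simp [dirDeriv, mvfderiv_fun_mul hf.mdiff hh.mdiff]

theorem dirDeriv_vadd (f : M → ℝ) (p : M) (v w : TangentSpace (𝓡 n) p) :
    dirDeriv f p (v + w) = dirDeriv f p v + dirDeriv f p w := by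
  simp [dirDeriv]

theorem dirDeriv_vsub (f : M → ℝ) (p : M) (v w : TangentSpace (𝓡 n) p) :
    dirDeriv f p (v - w) = dirDeriv f p v - dirDeriv f p w := by
  simp [dirDeriv]

theorem dirDeriv_vsmul (f : M → ℝ) (p : M) (c : ℝ) (v : TangentSpace (𝓡 n) p) :
    dirDeriv f p (c • v) = c * dirDeriv f p v := by
  simp [dirDeriv]

@[simp] theorem dirDeriv_vzero (f : M → ℝ) (p : M) :
    dirDeriv f p (0 : TangentSpace (𝓡 n) p) = 0 := by
  simp [dirDeriv]

theorem bracket_congr {X X' Y Y' : VField n M} {p : M} (hX : X =ᶠ[nhds p] X')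
    (hY : Y =ᶠ[nhds p] Y') : bracket X Y p = bracket X' Y' p :=
  Filter.EventuallyEq.mlieBracket_vectorField_eq hX hY

theorem bracket_swap (X Y : VField n M) (p : M) : bracket X Y p = -bracket Y X p :=
  VectorField.mlieBracket_swap_apply

@[simp] theorem bracket_self (X : VField n M) (p : M) : bracket X X p = 0 := by
  simp [bracket]

variable [IsManifold (𝓡 n) ∞ M]

theorem SmoothFieldOn.at {X : VField n M} {U : Set M} (hX : SmoothFieldOn X U) (hU : IsOpen U)
    {p : M} (hp : p ∈ U) : SmoothFieldAt X p :=
  ContMDiffOn.contMDiffAt hX (hU.mem_nhds hp)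

theorem SmoothFieldAt.mdiff {X : VField n M} {p : M} (hX : SmoothFieldAt X p) :
    MDifferentiableAt (𝓡 n) ((𝓡 n).prod 𝓘(ℝ, Model n))
      (fun q => (TotalSpace.mk' (Model n) q (X q) : TangentBundle (𝓡 n) M)) p :=
  ContMDiffAt.mdifferentiableAt hX (by simp)

@[simp] theorem extendVec_self {p : M} (v : TangentSpace (𝓡 n) p) :
    extendVec (n := n) v p = v :=
  FiberBundle.extend_apply_self (Model n) v

theorem SmoothFieldAt.smul {f : M → ℝ} {X : VField n M} {p : M} (hf : SmoothFnAt (n := n) f p)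
    (hX : SmoothFieldAt X p) : SmoothFieldAt (fun q => f q • X q) p :=
  ContMDiffAt.smul_section hf hX

theorem SmoothFieldAt.add {X Y : VField n M} {p : M} (hX : SmoothFieldAt X p)
    (hY : SmoothFieldAt Y p) : SmoothFieldAt (fun q => X q + Y q) p :=
  ContMDiffAt.add_section hX hY

theorem SmoothFieldAt.sub {X Y : VField n M} {p : M} (hX : SmoothFieldAt X p)
    (hY : SmoothFieldAt Y p) : SmoothFieldAt (fun q => X q - Y q) p :=
  ContMDiffAt.sub_section hX hY

theorem SmoothFieldAt.sum {ι : Type*} {s : Finset ι} {X : ι → VField n M} {p : M}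
    (hX : ∀ i ∈ s, SmoothFieldAt (X i) p) : SmoothFieldAt (fun q => ∑ i ∈ s, X i q) p :=
  ContMDiffAt.sum_section hX

theorem SmoothFieldAt.congr {X Y : VField n M} {p : M} (hX : SmoothFieldAt X p)
    (h : Y =ᶠ[nhds p] X) : SmoothFieldAt Y p :=
  ContMDiffAt.congr_of_eventuallyEq hX (h.mono fun q hq => by simp [hq])

theorem SmoothFieldAt.bracket {X Y : VField n M} {p : M} (hX : SmoothFieldAt X p)
    (hY : SmoothFieldAt Y p) : SmoothFieldAt (bracket X Y) p := by
  have : IsManifold (𝓡 n) (((⊤ : ℕ∞) : WithTop ℕ∞) + 1) M := by simpa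
  have : IsManifold (𝓡 n) (minSmoothness ℝ 2) M :=
    .of_le (n := ∞) (by simpa using ENat.LEInfty.out)
  exact ContMDiffAt.mlieBracket_vectorField (m := ⊤) (n := ⊤) hX hY (by simp)

theorem SmoothFieldAt.dirDeriv {f : M → ℝ} {X : VField n M} {p : M}
    (hf : SmoothFnAt (n := n) f p) (hX : SmoothFieldAt X p) :
    SmoothFnAt (n := n) (fun q => dirDeriv f q (X q)) p := by
  have : IsManifold (𝓡 n) 1 M := .of_le (n := ∞) (by simp)
  have h1 := ContMDiffAt.mfderiv_const (m := ∞) hf (by simp)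
  have h2 := ContMDiffAt.clm_apply_of_inCoordinates
    (F₁ := Model n) (F₂ := ℝ) (E₁ := TangentSpace (𝓡 n)) (E₂ := TangentSpace 𝓘(ℝ, ℝ))
    (b₁ := id) (b₂ := f) (m₀ := p) (ϕ := fun q => mfderiv (𝓡 n) 𝓘(ℝ, ℝ) f q) (v := X) h1 hX hf
  exact (contMDiffAt_totalSpace.1 h2).2.congr_of_eventuallyEq (by simp; rfl)

theorem bracket_smul_right {f : M → ℝ} {X Y : VField n M} {p : M}
    (hf : SmoothFnAt (n := n) f p) (hY : SmoothFieldAt Y p) :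
    bracket X (fun q => f q • Y q) p = dirDeriv f p (X p) • Y p + f p • bracket X Y p :=
  VectorField.mlieBracket_smul_right hf.mdiff hY.mdiff

theorem bracket_smul_left {f : M → ℝ} {X Y : VField n M} {p : M}
    (hf : SmoothFnAt (n := n) f p) (hX : SmoothFieldAt X p) :
    bracket (fun q => f q • X q) Y p = -dirDeriv f p (Y p) • X p + f p • bracket X Y p :=
  VectorField.mlieBracket_smul_left hf.mdiff hX.mdiff

theorem bracket_add_right {X Y Z : VField n M} {p : M}
    (hY : SmoothFieldAt Y p) (hZ : SmoothFieldAt Z p) :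
    bracket X (fun q => Y q + Z q) p = bracket X Y p + bracket X Z p :=
  VectorField.mlieBracket_add_right hY.mdiff hZ.mdiff

theorem bracket_add_left {X Y Z : VField n M} {p : M}
    (hX : SmoothFieldAt X p) (hY : SmoothFieldAt Y p) :
    bracket (fun q => X q + Y q) Z p = bracket X Z p + bracket Y Z p :=
  VectorField.mlieBracket_add_left hX.mdiff hY.mdiff

theorem bracket_leibniz {X Y Z : VField n M} {p : M}
    (hX : SmoothFieldAt X p) (hY : SmoothFieldAt Y p) (hZ : SmoothFieldAt Z p) :
    bracket X (bracket Y Z) p = bracket (bracket X Y) Z p + bracket Y (bracket X Z) p := by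
  have : IsManifold (𝓡 n) (minSmoothness ℝ 3) M :=
    .of_le (n := ∞) (by simpa using ENat.LEInfty.out)
  have h2 : minSmoothness ℝ 2 ≤ (∞ : WithTop ℕ∞) := by simpa using ENat.LEInfty.out
  exact VectorField.leibniz_identity_mlieBracket_apply (𝕜 := ℝ) (ContMDiffAt.of_le hX h2)
    (ContMDiffAt.of_le hY h2) (ContMDiffAt.of_le hZ h2)

end Calculus

/-! ### Germs of smooth functions and fields; tensoriality at a point -/

section Near

variable {n : ℕ} {M : Type*} [TopologicalSpace M] [ChartedSpace (Model n) M]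

/-- The function `f` is smooth on a neighbourhood of `p`. -/
def SmoothFnNear (f : M → ℝ) (p : M) : Prop := ∀ᶠ q in nhds p, SmoothFnAt (n := n) f q

theorem SmoothFnNear.at {f : M → ℝ} {p : M} (hf : SmoothFnNear (n := n) f p) :
    SmoothFnAt (n := n) f p := hf.self_of_nhds

theorem SmoothFnNear.eventually {f : M → ℝ} {p : M} (hf : SmoothFnNear (n := n) f p) :
    ∀ᶠ q in nhds p, SmoothFnNear (n := n) f q := eventually_eventually_nhds.2 hf

theorem SmoothFnNear.add {f h : M → ℝ} {p : M} (hf : SmoothFnNear (n := n) f p)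
    (hh : SmoothFnNear (n := n) h p) : SmoothFnNear (n := n) (fun q => f q + h q) p := by
  filter_upwards [hf, hh] with q h1 h2 using ContMDiffAt.add h1 h2

theorem SmoothFnNear.sub {f h : M → ℝ} {p : M} (hf : SmoothFnNear (n := n) f p)
    (hh : SmoothFnNear (n := n) h p) : SmoothFnNear (n := n) (fun q => f q - h q) p := by
  filter_upwards [hf, hh] with q h1 h2 using ContMDiffAt.sub h1 h2

theorem SmoothFnNear.mul {f h : M → ℝ} {p : M} (hf : SmoothFnNear (n := n) f p)
    (hh : SmoothFnNear (n := n) h p) : SmoothFnNear (n := n) (fun q => f q * h q) p := by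
  filter_upwards [hf, hh] with q h1 h2 using ContMDiffAt.mul h1 h2

theorem SmoothFnNear.neg {f : M → ℝ} {p : M} (hf : SmoothFnNear (n := n) f p) :
    SmoothFnNear (n := n) (fun q => -f q) p := by
  filter_upwards [hf] with q h1 using ContMDiffAt.neg h1

theorem smoothFnNear_const (c : ℝ) (p : M) : SmoothFnNear (n := n) (fun _ => c) p :=
  Filter.Eventually.of_forall fun _ => contMDiffAt_const

theorem SmoothFnNear.congr {f h : M → ℝ} {p : M} (hf : SmoothFnNear (n := n) f p)
    (hh : h =ᶠ[nhds p] f) : SmoothFnNear (n := n) h p := by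
  filter_upwards [hf, hh.eventually_nhds] with q h1 h2 using
    ContMDiffAt.congr_of_eventuallyEq h1 h2

variable [IsManifold (𝓡 n) ∞ M]

/-- The vector field `X` is smooth on a neighbourhood of `p`. -/
def SmoothFieldNear (X : VField n M) (p : M) : Prop := ∀ᶠ q in nhds p, SmoothFieldAt X q

theorem SmoothFieldOn.near {X : VField n M} {U : Set M} (hX : SmoothFieldOn X U) (hU : IsOpen U)
    {p : M} (hp : p ∈ U) : SmoothFieldNear X p := by
  filter_upwards [hU.mem_nhds hp] with q hq using hX.at hU hq

theorem SmoothFieldNear.at {X : VField n M} {p : M} (hX : SmoothFieldNear X p) :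
    SmoothFieldAt X p := hX.self_of_nhds

theorem SmoothFieldNear.eventually {X : VField n M} {p : M} (hX : SmoothFieldNear X p) :
    ∀ᶠ q in nhds p, SmoothFieldNear X q := eventually_eventually_nhds.2 hX

theorem smoothFieldNear_extendVec {p : M} (v : TangentSpace (𝓡 n) p) :
    SmoothFieldNear (extendVec v) p := by
  obtain ⟨s, hs, h⟩ := FiberBundle.exists_contMDiffOn_extend (k := ∞) (𝓡 n) (Model n) v
  filter_upwards [eventually_mem_nhds_iff.2 hs] with q hq using h.contMDiffAt hq

theorem SmoothFieldNear.smul {f : M → ℝ} {X : VField n M} {p : M}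
    (hf : SmoothFnNear (n := n) f p) (hX : SmoothFieldNear X p) :
    SmoothFieldNear (fun q => f q • X q) p := by
  filter_upwards [hf, hX] with q h1 h2 using h2.smul h1

theorem SmoothFieldNear.add {X Y : VField n M} {p : M} (hX : SmoothFieldNear X p)
    (hY : SmoothFieldNear Y p) : SmoothFieldNear (fun q => X q + Y q) p := by
  filter_upwards [hX, hY] with q h1 h2 using h1.add h2

theorem SmoothFieldNear.sum {ι : Type*} {s : Finset ι} {X : ι → VField n M} {p : M}
    (hX : ∀ i ∈ s, SmoothFieldNear (X i) p) : SmoothFieldNear (fun q => ∑ i ∈ s, X i q) p := by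
  filter_upwards [(Filter.eventually_all_finset s).2 hX] with q hq using SmoothFieldAt.sum hq

theorem SmoothFieldNear.congr {X Y : VField n M} {p : M} (hX : SmoothFieldNear X p)
    (h : Y =ᶠ[nhds p] X) : SmoothFieldNear Y p := by
  filter_upwards [hX, h.eventually_nhds] with q h1 h2 using h1.congr h2

theorem SmoothFieldNear.bracket {X Y : VField n M} {p : M} (hX : SmoothFieldNear X p)
    (hY : SmoothFieldNear Y p) : SmoothFieldNear (bracket X Y) p := by
  filter_upwards [hX, hY] with q h1 h2 using h1.bracket h2

theorem SmoothFnNear.dirDeriv {f : M → ℝ} {X : VField n M} {p : M}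
    (hf : SmoothFnNear (n := n) f p) (hX : SmoothFieldNear X p) :
    SmoothFnNear (n := n) (fun q => dirDeriv f q (X q)) p := by
  filter_upwards [hf, hX] with q h1 h2 using SmoothFieldAt.dirDeriv h1 h2

/-- An operation on vector fields is tensorial at `p` if it is additive and homogeneous with
respect to functions, for smooth functions and fields near `p`. -/
structure TensorialNear {A : Type*} [AddCommGroup A] [Module ℝ A] (Φ : VField n M → A) (p : M) :
    Prop where
  smul : ∀ (f : M → ℝ) (X : VField n M), SmoothFnNear (n := n) f p → SmoothFieldNear X p →
    Φ (fun q => f q • X q) = f p • Φ X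
  add : ∀ X Y : VField n M, SmoothFieldNear X p → SmoothFieldNear Y p →
    Φ (fun q => X q + Y q) = Φ X + Φ Y

namespace TensorialNear

variable {A : Type*} [AddCommGroup A] [Module ℝ A] {Φ : VField n M → A} {p : M}

theorem congr (hΦ : TensorialNear Φ p) {X Y : VField n M} (hX : SmoothFieldNear X p)
    (hY : SmoothFieldNear Y p) (h : X =ᶠ[nhds p] Y) : Φ X = Φ Y := by
  classical
  -- No bump function is needed: smoothness is required only near p, where ψ is identically 1, while
  -- ψX = ψY holds globally.
  let ψ : M → ℝ := fun q => if X q = Y q then 1 else 0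
  have hψ1 : ψ =ᶠ[nhds p] fun _ => 1 := by
    filter_upwards [h] with q hq
    simp [ψ, hq]
  have hψ : SmoothFnNear (n := n) ψ p := (smoothFnNear_const 1 p).congr hψ1
  have hp : ψ p = 1 := hψ1.self_of_nhds
  have heq : (fun q => ψ q • X q) = fun q => ψ q • Y q := by
    funext q
    by_cases hq : X q = Y q <;> simp [ψ, hq]
  have h1 := hΦ.smul ψ X hψ hX
  have h2 := hΦ.smul ψ Y hψ hY
  rw [hp, one_smul] at h1 h2
  rw [← h1, ← h2, heq]

theorem zero (hΦ : TensorialNear Φ p) : Φ (fun _ => 0) = 0 := by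
  have h0 : SmoothFieldNear (extendVec (n := n) (0 : TangentSpace (𝓡 n) p)) p :=
    smoothFieldNear_extendVec _
  simpa using hΦ.smul (fun _ => 0) _ (smoothFnNear_const 0 p) h0

theorem sum (hΦ : TensorialNear Φ p) {ι : Type*} {s : Finset ι} {X : ι → VField n M}
    (hX : ∀ i ∈ s, SmoothFieldNear (X i) p) :
    Φ (fun q => ∑ i ∈ s, X i q) = ∑ i ∈ s, Φ (X i) := by
  classical
  induction s using Finset.induction_on with
  | empty => simpa using hΦ.zero
  | insert a s ha ih =>
    simp only [Finset.sum_insert ha]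
    rw [hΦ.add _ _ (hX a (by simp)) (SmoothFieldNear.sum fun i hi => hX i (by simp [hi])),
      ih fun i hi => hX i (by simp [hi])]

end TensorialNear

theorem PseudoMetric.smoothFnAt_val (g : PseudoMetric n M) {X Y : VField n M} {p : M}
    (hX : SmoothFieldAt X p) (hY : SmoothFieldAt Y p) :
    SmoothFnAt (n := n) (fun q => g.val q (X q) (Y q)) p := by
  have : ContMDiffAt (𝓡 n) ((𝓡 n).prod 𝓘(ℝ, ℝ)) ∞
      (fun q ↦ TotalSpace.mk' ℝ (E := Bundle.Trivial M ℝ) q (g.val q (X q) (Y q))) p :=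
    ContMDiffAt.clm_bundle_apply₂ (F₁ := Model n) (F₂ := Model n) g.smooth.contMDiffAt hX hY
  simp only [contMDiffAt_totalSpace] at this
  exact this.2

theorem PseudoMetric.smoothFnNear_val (g : PseudoMetric n M) {X Y : VField n M} {p : M}
    (hX : SmoothFieldNear X p) (hY : SmoothFieldNear Y p) :
    SmoothFnNear (n := n) (fun q => g.val q (X q) (Y q)) p := by
  filter_upwards [hX, hY] with q h1 h2 using g.smoothFnAt_val h1 h2

/-- The commutator formula `[X, Y] f = X (Y f) - Y (X f)`. -/
theorem dirDeriv_bracket {f : M → ℝ} {X Y : VField n M} {p : M}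
    (hf : SmoothFnNear (n := n) f p) (hX : SmoothFieldNear X p) (hY : SmoothFieldNear Y p) :
    dirDeriv f p (bracket X Y p) =
      dirDeriv (fun q => dirDeriv f q (Y q)) p (X p)
        - dirDeriv (fun q => dirDeriv f q (X q)) p (Y p) := by
  -- The formula is extracted from the Jacobi identity for X, Y, fZ: after subtracting f times the
  -- identity for X, Y, Z, only a multiple of Z is left. This needs Z p ≠ 0, hence the separate
  -- zero-dimensional case.
  rcases subsingleton_or_nontrivial (TangentSpace (𝓡 n) p) with hs | hs
  · have h0 : ∀ v : TangentSpace (𝓡 n) p, v = 0 := fun v => Subsingleton.elim _ _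
    rw [h0 (bracket X Y p), h0 (X p), h0 (Y p)]
    simp
  obtain ⟨v, hv⟩ := exists_ne (0 : TangentSpace (𝓡 n) p)
  set Z : VField n M := extendVec v with hZdef
  have hZ : SmoothFieldNear Z p := smoothFieldNear_extendVec v
  have hZp : Z p = v := extendVec_self v
  have inner : ∀ W : VField n M, (∀ᶠ q in nhds p, SmoothFieldAt W q) →
      bracket W (fun q => f q • Z q) =ᶠ[nhds p]
        fun q => dirDeriv f q (W q) • Z q + f q • bracket W Z q := by
    intro W _
    filter_upwards [hf, hZ] with q h1 h2 using bracket_smul_right h1 h2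
  have expand : ∀ W W' : VField n M, SmoothFieldNear W p → SmoothFieldNear W' p →
      bracket W (bracket W' (fun q => f q • Z q)) p =
        dirDeriv (fun q => dirDeriv f q (W' q)) p (W p) • Z p
          + dirDeriv f p (W' p) • bracket W Z p
          + (dirDeriv f p (W p) • bracket W' Z p + f p • bracket W (bracket W' Z) p) := by
    intro W W' hW hW'
    rw [bracket_congr (Filter.EventuallyEq.refl _ W) (inner W' hW'),
      bracket_add_right (hZ.at.smul (hf.dirDeriv hW').at) ((hW'.bracket hZ).at.smul hf.at),
      bracket_smul_right (hf.dirDeriv hW').at hZ.at,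
      bracket_smul_right hf.at (hW'.bracket hZ).at]
  have key := bracket_leibniz hX.at hY.at (SmoothFieldNear.smul hf hZ).at
  rw [expand X Y hX hY, expand Y X hY hX, bracket_smul_right hf.at hZ.at,
    bracket_leibniz hX.at hY.at hZ.at, hZp] at key
  have h0 : (dirDeriv f p (bracket X Y p)
      - (dirDeriv (fun q => dirDeriv f q (Y q)) p (X p)
        - dirDeriv (fun q => dirDeriv f q (X q)) p (Y p))) • v = 0 := by
    rw [← neg_zero, ← sub_eq_zero.2 key]
    module
  exact sub_eq_zero.1 ((smul_eq_zero.1 h0).resolve_right hv)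

end Near

/-! ### Pseudo-orthonormal frames and the Levi-Civita connection -/

section Frame

variable {n : ℕ} {M : Type*} [TopologicalSpace M] [ChartedSpace (Model n) M]
  [IsManifold (𝓡 n) ∞ M]

/-- A smooth pseudo-orthonormal frame of `g` on the open set `U`, with signs `s i = g(Eᵢ, Eᵢ)`. -/
structure PseudoMetric.IsFrame (g : PseudoMetric n M) (U : Set M) (E : Fin n → VField n M)
    (s : Fin n → ℝ) : Prop where
  isOpen : IsOpen U
  smooth : ∀ i, SmoothFieldOn (E i) U
  sign : ∀ i, s i * s i = 1
  val_self : ∀ p ∈ U, ∀ i, g.val p (E i p) (E i p) = s i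
  val_ne : ∀ p ∈ U, ∀ i j, i ≠ j → g.val p (E i p) (E j p) = 0

namespace PseudoMetric

variable {g : PseudoMetric n M} {U : Set M} {E : Fin n → VField n M} {s : Fin n → ℝ}

theorem val_sum_left {ι : Type*} (t : Finset ι) (p : M) (v : ι → TangentSpace (𝓡 n) p)
    (w : TangentSpace (𝓡 n) p) : g.val p (∑ i ∈ t, v i) w = ∑ i ∈ t, g.val p (v i) w := by
  rw [map_sum, sum_apply]

theorem IsFrame.val_frame (hE : g.IsFrame U E s) {p : M} (hp : p ∈ U) (i j : Fin n) :
    g.val p (E i p) (E j p) = if i = j then s i else 0 := by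
  split_ifs with h
  · subst h; exact hE.val_self p hp i
  · exact hE.val_ne p hp i j h

theorem IsFrame.near (hE : g.IsFrame U E s) {p : M} (hp : p ∈ U) (i : Fin n) :
    SmoothFieldNear (E i) p := (hE.smooth i).near hE.isOpen hp

theorem IsFrame.val_sum_smul (hE : g.IsFrame U E s) {p : M} (hp : p ∈ U) (c : Fin n → ℝ)
    (j : Fin n) : g.val p (∑ i, c i • E i p) (E j p) = c j * s j := by
  rw [val_sum_left]
  simp [hE.val_frame hp]

theorem IsFrame.linearIndependent (hE : g.IsFrame U E s) {p : M} (hp : p ∈ U) :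
    LinearIndependent ℝ fun i => E i p := by
  rw [Fintype.linearIndependent_iff]
  intro c hc j
  have h := hE.val_sum_smul hp c j
  rw [hc] at h
  have h2 := hE.sign j
  have : c j * s j = 0 := by simpa using h.symm
  linear_combination (-c j) * h2 + s j * this

/-- The basis of the tangent space given by a frame. -/
noncomputable def IsFrame.basis (hE : g.IsFrame U E s) {p : M} (hp : p ∈ U) :
    Module.Basis (Fin n) ℝ (TangentSpace (𝓡 n) p) :=
  have : FiniteDimensional ℝ (TangentSpace (𝓡 n) p) :=
    inferInstanceAs (FiniteDimensional ℝ (Model n))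
  basisOfLinearIndependentOfCardEqFinrank' (fun i => E i p) (hE.linearIndependent hp)
    (by rw [Fintype.card_fin]; exact (finrank_euclideanSpace_fin (𝕜 := ℝ) (n := n)).symm)

theorem IsFrame.basis_apply (hE : g.IsFrame U E s) {p : M} (hp : p ∈ U) (i : Fin n) :
    hE.basis hp i = E i p := by
  simp [IsFrame.basis]

theorem IsFrame.basis_repr (hE : g.IsFrame U E s) {p : M} (hp : p ∈ U)
    (v : TangentSpace (𝓡 n) p) (i : Fin n) : (hE.basis hp).repr v i = s i * g.val p v (E i p) := by
  have h := hE.val_sum_smul hp (fun j => (hE.basis hp).repr v j) i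
  have hv := (hE.basis hp).sum_repr v
  simp only [hE.basis_apply] at hv
  rw [hv] at h
  rw [h]
  linear_combination (-(hE.basis hp).repr v i) * hE.sign i

theorem IsFrame.expand (hE : g.IsFrame U E s) {p : M} (hp : p ∈ U) (v : TangentSpace (𝓡 n) p) :
    v = ∑ i, (s i * g.val p v (E i p)) • E i p := by
  conv_lhs => rw [← (hE.basis hp).sum_repr v]
  simp only [hE.basis_apply, hE.basis_repr]

theorem IsFrame.coeff_near (hE : g.IsFrame U E s) {p : M} (hp : p ∈ U) {X : VField n M}
    (hX : SmoothFieldNear X p) (i : Fin n) :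
    SmoothFnNear (n := n) (fun q => s i * g.val q (X q) (E i q)) p :=
  (smoothFnNear_const _ _).mul (g.smoothFnNear_val hX (hE.near hp i))

/-- The expansion of X in the frame has smooth coefficients but holds only on U, so locality
(`TensorialNear.congr`) is used before linearity. -/
theorem IsFrame.tensorial {A : Type*} [AddCommGroup A] [Module ℝ A] {Φ : VField n M → A}
    (hE : g.IsFrame U E s) {p : M} (hp : p ∈ U) (hΦ : TensorialNear Φ p) {X : VField n M}
    (hX : SmoothFieldNear X p) : Φ X = ∑ i, (s i * g.val p (X p) (E i p)) • Φ (E i) := by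
  have hi : ∀ i ∈ Finset.univ,
      SmoothFieldNear (fun q => (s i * g.val q (X q) (E i q)) • E i q) p :=
    fun i _ => (hE.near hp i).smul (hE.coeff_near hp hX i)
  have heq : X =ᶠ[nhds p] fun q => ∑ i, (s i * g.val q (X q) (E i q)) • E i q := by
    filter_upwards [hE.isOpen.mem_nhds hp] with q hq using hE.expand hq _
  rw [hΦ.congr hX (SmoothFieldNear.sum hi) heq, hΦ.sum hi]
  exact Finset.sum_congr rfl fun i _ => hΦ.smul _ _ (hE.coeff_near hp hX i) (hE.near hp i)

/-- The terms X(f)g(Y,Z) and Y(f)g(Z,X) cancel against those from [X, fZ] and [Y, fZ]. This lets the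
test vectors in the definition of `nabla` be replaced by a frame. -/
theorem tensorial_koszul {X Y : VField n M} {p : M} (hX : SmoothFieldNear X p)
    (hY : SmoothFieldNear Y p) : TensorialNear (fun Z => g.koszul X Y Z p) p where
  smul f Z hf hZ := by
    have h1 : dirDeriv (fun q => g.val q (Y q) (f q • Z q)) p (X p) =
        f p * dirDeriv (fun q => g.val q (Y q) (Z q)) p (X p)
          + g.val p (Y p) (Z p) * dirDeriv f p (X p) := by
      simp only [map_smul, smul_eq_mul]
      exact dirDeriv_mul hf.at (g.smoothFnNear_val hY hZ).at _
    have h2 : dirDeriv (fun q => g.val q (f q • Z q) (X q)) p (Y p) =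
        f p * dirDeriv (fun q => g.val q (Z q) (X q)) p (Y p)
          + g.val p (Z p) (X p) * dirDeriv f p (Y p) := by
      simp only [map_smul, smul_apply, smul_eq_mul]
      exact dirDeriv_mul hf.at (g.smoothFnNear_val hZ hX).at _
    simp only [map_smul, smul_apply, smul_eq_mul] at h1 h2
    simp only [koszul, h1, h2, bracket_smul_right hf.at hZ.at, dirDeriv_vsmul, map_add, map_smul,
      add_apply, smul_apply, smul_eq_mul]
    rw [g.symm p (Z p) (X p), g.symm p (Z p) (Y p)]
    ring
  add Z W hZ hW := by
    have h1 : dirDeriv (fun q => g.val q (Y q) (Z q + W q)) p (X p) =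
        dirDeriv (fun q => g.val q (Y q) (Z q)) p (X p)
          + dirDeriv (fun q => g.val q (Y q) (W q)) p (X p) := by
      simp only [map_add]
      exact dirDeriv_add (g.smoothFnNear_val hY hZ).at (g.smoothFnNear_val hY hW).at _
    have h2 : dirDeriv (fun q => g.val q (Z q + W q) (X q)) p (Y p) =
        dirDeriv (fun q => g.val q (Z q) (X q)) p (Y p)
          + dirDeriv (fun q => g.val q (W q) (X q)) p (Y p) := by
      simp only [map_add, add_apply]
      exact dirDeriv_add (g.smoothFnNear_val hZ hX).at (g.smoothFnNear_val hW hX).at _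
    simp only [map_add, add_apply] at h1 h2
    simp only [koszul, h1, h2, bracket_add_right hZ.at hW.at, dirDeriv_vadd, map_add,
      add_apply]
    ring

theorem sum_val_smul_dualBasis (p : M) (v : TangentSpace (𝓡 n) p) :
    ∑ i, g.val p (tangentBasis p i) v • g.dualBasis p i = v := by
  conv_rhs => rw [← (g.dualBasis p).sum_repr v]
  refine Finset.sum_congr rfl fun i _ => ?_
  congr 1
  rw [dualBasis, LinearMap.BilinForm.dualBasis_repr_apply]
  exact g.symm _ _ _

/-- The Koszul formula in a pseudo-orthonormal frame. -/
theorem IsFrame.nabla_eq (hE : g.IsFrame U E s) {p : M} (hp : p ∈ U) {X Y : VField n M}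
    (hX : SmoothFieldNear X p) (hY : SmoothFieldNear Y p) :
    g.nabla X Y p = ∑ i, (s i * (g.koszul X Y (E i) p / 2)) • E i p := by
  have h1 : ∀ i, g.koszul X Y (extendVec (tangentBasis p i)) p =
      ∑ j, (s j * g.val p (tangentBasis p i) (E j p)) • g.koszul X Y (E j) p := by
    intro i
    have := hE.tensorial hp (tensorial_koszul (g := g) hX hY)
      (smoothFieldNear_extendVec (tangentBasis p i))
    simpa only [extendVec_self] using this
  simp only [nabla, h1, Finset.sum_div, Finset.sum_smul]
  rw [Finset.sum_comm]
  refine Finset.sum_congr rfl fun j _ => ?_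
  -- After the exchange of sums, the inner sum is the expansion of E j in the dual basis.
  conv_rhs => rw [← sum_val_smul_dualBasis (g := g) p (E j p)]
  rw [Finset.smul_sum]
  refine Finset.sum_congr rfl fun i _ => ?_
  rw [smul_smul, smul_eq_mul]
  congr 1
  ring

theorem smoothFnNear_koszul {X Y Z : VField n M} {p : M} (hX : SmoothFieldNear X p)
    (hY : SmoothFieldNear Y p) (hZ : SmoothFieldNear Z p) :
    SmoothFnNear (n := n) (g.koszul X Y Z) p :=
  (((((g.smoothFnNear_val hY hZ).dirDeriv hX).add ((g.smoothFnNear_val hZ hX).dirDeriv hY)).sub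
    ((g.smoothFnNear_val hX hY).dirDeriv hZ)).add
    (g.smoothFnNear_val (hX.bracket hY) hZ)).sub (g.smoothFnNear_val (hX.bracket hZ) hY) |>.sub
    (g.smoothFnNear_val (hY.bracket hZ) hX)

theorem IsFrame.nabla_near (hE : g.IsFrame U E s) {p : M} (hp : p ∈ U) {X Y : VField n M}
    (hX : SmoothFieldNear X p) (hY : SmoothFieldNear Y p) : SmoothFieldNear (g.nabla X Y) p := by
  have h : SmoothFieldNear (fun q => ∑ i, (s i * (g.koszul X Y (E i) q * (1 / 2))) • E i q) p :=
    SmoothFieldNear.sum fun i _ => (hE.near hp i).smul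
      ((smoothFnNear_const _ _).mul
        ((smoothFnNear_koszul hX hY (hE.near hp i)).mul (smoothFnNear_const _ _)))
  refine h.congr ?_
  filter_upwards [hE.isOpen.mem_nhds hp, hX.eventually, hY.eventually] with q hq h1 h2
  rw [hE.nabla_eq hq h1 h2]
  exact Finset.sum_congr rfl fun i _ => by rw [div_eq_mul_one_div (g.koszul X Y (E i) q)]

/-- Locality of the connection; needed because identities between frame fields hold only on U, while
second covariant derivatives take global fields as arguments. -/
theorem IsFrame.nabla_congr (hE : g.IsFrame U E s) {p : M} (hp : p ∈ U) {X X' Y Y' : VField n M}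
    (hX : SmoothFieldNear X p) (hY : SmoothFieldNear Y p) (hXX' : X' =ᶠ[nhds p] X)
    (hYY' : Y' =ᶠ[nhds p] Y) : g.nabla X' Y' p = g.nabla X Y p := by
  rw [hE.nabla_eq hp (hX.congr hXX') (hY.congr hYY'), hE.nabla_eq hp hX hY]
  refine Finset.sum_congr rfl fun i _ => ?_
  have h1 : (fun q => g.val q (Y' q) (E i q)) =ᶠ[nhds p] fun q => g.val q (Y q) (E i q) := by
    filter_upwards [hYY'] with q h; rw [h]
  have h2 : (fun q => g.val q (E i q) (X' q)) =ᶠ[nhds p] fun q => g.val q (E i q) (X q) := by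
    filter_upwards [hXX'] with q h; rw [h]
  have h3 : (fun q => g.val q (X' q) (Y' q)) =ᶠ[nhds p] fun q => g.val q (X q) (Y q) := by
    filter_upwards [hXX', hYY'] with q h h'; rw [h, h']
  simp only [koszul, dirDeriv_congr h1, dirDeriv_congr h2, dirDeriv_congr h3,
    bracket_congr hXX' hYY', bracket_congr hXX' (Filter.EventuallyEq.refl _ (E i)),
    bracket_congr hYY' (Filter.EventuallyEq.refl _ (E i)), hXX'.self_of_nhds, hYY'.self_of_nhds]

theorem IsFrame.tensorial_nabla (hE : g.IsFrame U E s) {p : M} (hp : p ∈ U) {Y : VField n M}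
    (hY : SmoothFieldNear Y p) : TensorialNear (fun X => g.nabla X Y p) p where
  smul f X hf hX := by
    rw [hE.nabla_eq hp (hX.smul hf) hY, hE.nabla_eq hp hX hY, Finset.smul_sum]
    refine Finset.sum_congr rfl fun i _ => ?_
    rw [smul_smul]
    congr 1
    have hZ := hE.near hp i
    have h1 : dirDeriv (fun q => g.val q (E i q) (f q • X q)) p (Y p) =
        f p * dirDeriv (fun q => g.val q (E i q) (X q)) p (Y p)
          + g.val p (E i p) (X p) * dirDeriv f p (Y p) := by
      simp only [map_smul, smul_eq_mul]
      exact dirDeriv_mul hf.at (g.smoothFnNear_val hZ hX).at _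
    have h2 : dirDeriv (fun q => g.val q (f q • X q) (Y q)) p (E i p) =
        f p * dirDeriv (fun q => g.val q (X q) (Y q)) p (E i p)
          + g.val p (X p) (Y p) * dirDeriv f p (E i p) := by
      simp only [map_smul, smul_apply, smul_eq_mul]
      exact dirDeriv_mul hf.at (g.smoothFnNear_val hX hY).at _
    simp only [map_smul, smul_apply, smul_eq_mul] at h1 h2
    simp only [koszul, h1, h2, bracket_smul_left hf.at hX.at, dirDeriv_vsmul, map_add, map_smul,
      add_apply, smul_apply, smul_eq_mul]
    rw [g.symm p (E i p) (X p)]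
    ring
  add X X' hX hX' := by
    rw [hE.nabla_eq hp (hX.add hX') hY, hE.nabla_eq hp hX hY, hE.nabla_eq hp hX' hY,
      ← Finset.sum_add_distrib]
    refine Finset.sum_congr rfl fun i _ => ?_
    rw [← add_smul]
    congr 1
    have hZ := hE.near hp i
    have h1 : dirDeriv (fun q => g.val q (E i q) (X q + X' q)) p (Y p) =
        dirDeriv (fun q => g.val q (E i q) (X q)) p (Y p)
          + dirDeriv (fun q => g.val q (E i q) (X' q)) p (Y p) := by
      simp only [map_add]
      exact dirDeriv_add (g.smoothFnNear_val hZ hX).at (g.smoothFnNear_val hZ hX').at _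
    have h2 : dirDeriv (fun q => g.val q (X q + X' q) (Y q)) p (E i p) =
        dirDeriv (fun q => g.val q (X q) (Y q)) p (E i p)
          + dirDeriv (fun q => g.val q (X' q) (Y q)) p (E i p) := by
      simp only [map_add, add_apply]
      exact dirDeriv_add (g.smoothFnNear_val hX hY).at (g.smoothFnNear_val hX' hY).at _
    simp only [map_add, add_apply] at h1 h2
    simp only [koszul, h1, h2, bracket_add_left hX.at hX'.at, dirDeriv_vadd, map_add,
      add_apply]
    ring

/-- In the Koszul expression the Z(f) terms cancel and X(f)g(Y,Z) occurs twice, once from the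
derivative of g(fY,Z) and once from [X, fY]; halving gives the Leibniz term. -/
theorem IsFrame.nabla_smul_right (hE : g.IsFrame U E s) {p : M} (hp : p ∈ U) {f : M → ℝ}
    {X Y : VField n M} (hf : SmoothFnNear (n := n) f p) (hX : SmoothFieldNear X p)
    (hY : SmoothFieldNear Y p) :
    g.nabla X (fun q => f q • Y q) p = dirDeriv f p (X p) • Y p + f p • g.nabla X Y p := by
  rw [hE.nabla_eq hp hX (hY.smul hf), hE.nabla_eq hp hX hY]
  conv_rhs => rw [hE.expand hp (Y p)]
  rw [Finset.smul_sum, Finset.smul_sum, ← Finset.sum_add_distrib]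
  refine Finset.sum_congr rfl fun i _ => ?_
  rw [smul_smul, smul_smul, ← add_smul]
  congr 1
  have hZ := hE.near hp i
  have h1 : dirDeriv (fun q => g.val q (f q • Y q) (E i q)) p (X p) =
      f p * dirDeriv (fun q => g.val q (Y q) (E i q)) p (X p)
        + g.val p (Y p) (E i p) * dirDeriv f p (X p) := by
    simp only [map_smul, smul_apply, smul_eq_mul]
    exact dirDeriv_mul hf.at (g.smoothFnNear_val hY hZ).at _
  have h2 : dirDeriv (fun q => g.val q (X q) (f q • Y q)) p (E i p) =
      f p * dirDeriv (fun q => g.val q (X q) (Y q)) p (E i p)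
        + g.val p (X p) (Y p) * dirDeriv f p (E i p) := by
    simp only [map_smul, smul_eq_mul]
    exact dirDeriv_mul hf.at (g.smoothFnNear_val hX hY).at _
  simp only [map_smul, smul_apply, smul_eq_mul] at h1 h2
  simp only [koszul, h1, h2, bracket_smul_left hf.at hY.at, bracket_smul_right hf.at hY.at,
    dirDeriv_vsmul, map_add, map_smul,
    add_apply, smul_apply, smul_eq_mul]
  rw [g.symm p (Y p) (X p)]
  ring

theorem IsFrame.nabla_add_right (hE : g.IsFrame U E s) {p : M} (hp : p ∈ U)
    {X Y Y' : VField n M} (hX : SmoothFieldNear X p)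
    (hY : SmoothFieldNear Y p) (hY' : SmoothFieldNear Y' p) :
    g.nabla X (fun q => Y q + Y' q) p = g.nabla X Y p + g.nabla X Y' p := by
  rw [hE.nabla_eq hp hX (hY.add hY'), hE.nabla_eq hp hX hY, hE.nabla_eq hp hX hY',
    ← Finset.sum_add_distrib]
  refine Finset.sum_congr rfl fun i _ => ?_
  rw [← add_smul]
  congr 1
  have hZ := hE.near hp i
  have h1 : dirDeriv (fun q => g.val q (Y q + Y' q) (E i q)) p (X p) =
      dirDeriv (fun q => g.val q (Y q) (E i q)) p (X p)
        + dirDeriv (fun q => g.val q (Y' q) (E i q)) p (X p) := by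
    simp only [map_add, add_apply]
    exact dirDeriv_add (g.smoothFnNear_val hY hZ).at (g.smoothFnNear_val hY' hZ).at _
  have h2 : dirDeriv (fun q => g.val q (X q) (Y q + Y' q)) p (E i p) =
      dirDeriv (fun q => g.val q (X q) (Y q)) p (E i p)
        + dirDeriv (fun q => g.val q (X q) (Y' q)) p (E i p) := by
    simp only [map_add]
    exact dirDeriv_add (g.smoothFnNear_val hX hY).at (g.smoothFnNear_val hX hY').at _
  simp only [map_add, add_apply] at h1 h2
  simp only [koszul, h1, h2, bracket_add_left hY.at hY'.at, bracket_add_right hY.at hY'.at,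
    dirDeriv_vadd, map_add, add_apply]
  ring

end PseudoMetric

end Frame

/-! ### Curvature and its traces in a frame; structure equations -/

namespace PseudoMetric

section Curvature

variable {n : ℕ} {M : Type*} [TopologicalSpace M] [ChartedSpace (Model n) M]
  [IsManifold (𝓡 n) ∞ M]

variable {g : PseudoMetric n M} {U : Set M} {E : Fin n → VField n M} {s : Fin n → ℝ}

theorem IsFrame.nabla_eventuallyEq_smul_left (hE : g.IsFrame U E s) {p : M} (hp : p ∈ U)
    {f : M → ℝ} {X Y : VField n M} (hf : SmoothFnNear (n := n) f p) (hX : SmoothFieldNear X p)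
    (hY : SmoothFieldNear Y p) :
    g.nabla (fun q => f q • X q) Y =ᶠ[nhds p] fun q => f q • g.nabla X Y q := by
  filter_upwards [hE.isOpen.mem_nhds hp, hf.eventually, hX.eventually, hY.eventually]
    with q hq h1 h2 h3 using (hE.tensorial_nabla hq h3).smul f X h1 h2

theorem IsFrame.nabla_eventuallyEq_smul_right (hE : g.IsFrame U E s) {p : M} (hp : p ∈ U)
    {f : M → ℝ} {X Y : VField n M} (hf : SmoothFnNear (n := n) f p) (hX : SmoothFieldNear X p)
    (hY : SmoothFieldNear Y p) :
    g.nabla X (fun q => f q • Y q) =ᶠ[nhds p]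
      fun q => dirDeriv f q (X q) • Y q + f q • g.nabla X Y q := by
  filter_upwards [hE.isOpen.mem_nhds hp, hf.eventually, hX.eventually, hY.eventually]
    with q hq h1 h2 h3 using hE.nabla_smul_right hq h1 h2 h3

/-- The term −Y(f)X in [fX, Y] compensates the derivative of f in ∇_Y(f∇_X Z). -/
theorem IsFrame.tensorial_curvature_left (hE : g.IsFrame U E s) {p : M} (hp : p ∈ U)
    {Y Z : VField n M} (hY : SmoothFieldNear Y p) (hZ : SmoothFieldNear Z p) :
    TensorialNear (fun X => g.curvature X Y Z p) p where
  smul f X hf hX := by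
    have hYf := hf.dirDeriv hY
    have hXZ := hE.nabla_near hp hX hZ
    have hYZ := hE.nabla_near hp hY hZ
    have h1 : bracket (fun q => f q • X q) Y =ᶠ[nhds p]
        fun q => (-dirDeriv f q (Y q)) • X q + f q • bracket X Y q := by
      filter_upwards [hf, hX] with q h1 h2 using bracket_smul_left h1 h2
    have hB1 := hX.smul hYf.neg
    have hB2 := (hX.bracket hY).smul hf
    have e1 : g.nabla (bracket (fun q => f q • X q) Y) Z p =
        (-dirDeriv f p (Y p)) • g.nabla X Z p + f p • g.nabla (bracket X Y) Z p := by
      rw [hE.nabla_congr hp (hB1.add hB2) hZ h1 (Filter.EventuallyEq.refl _ Z),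
        (hE.tensorial_nabla hp hZ).add _ _ hB1 hB2, (hE.tensorial_nabla hp hZ).smul _ _ hYf.neg hX,
        (hE.tensorial_nabla hp hZ).smul _ _ hf (hX.bracket hY)]
    have e2 := (hE.tensorial_nabla hp hYZ).smul f X hf hX
    have e3 : g.nabla Y (g.nabla (fun q => f q • X q) Z) p =
        dirDeriv f p (Y p) • g.nabla X Z p + f p • g.nabla Y (g.nabla X Z) p := by
      rw [hE.nabla_congr hp hY (hXZ.smul hf) (Filter.EventuallyEq.refl _ Y)
        (hE.nabla_eventuallyEq_smul_left hp hf hX hZ), hE.nabla_smul_right hp hf hY hXZ]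
    simp only [curvature, e1, e2, e3]
    module
  add X X' hX hX' := by
    have hXZ := hE.nabla_near hp hX hZ
    have hXZ' := hE.nabla_near hp hX' hZ
    have hYZ := hE.nabla_near hp hY hZ
    have h1 : bracket (fun q => X q + X' q) Y =ᶠ[nhds p]
        fun q => bracket X Y q + bracket X' Y q := by
      filter_upwards [hX, hX'] with q h1 h2 using bracket_add_left h1 h2
    have hB1 := hX.bracket hY
    have hB2 := hX'.bracket hY
    have e1 : g.nabla (bracket (fun q => X q + X' q) Y) Z p =
        g.nabla (bracket X Y) Z p + g.nabla (bracket X' Y) Z p := by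
      rw [hE.nabla_congr hp (hB1.add hB2) hZ h1 (Filter.EventuallyEq.refl _ Z),
        (hE.tensorial_nabla hp hZ).add _ _ hB1 hB2]
    have e2 := (hE.tensorial_nabla hp hYZ).add X X' hX hX'
    have e3 : g.nabla Y (g.nabla (fun q => X q + X' q) Z) p =
        g.nabla Y (g.nabla X Z) p + g.nabla Y (g.nabla X' Z) p := by
      have h : g.nabla (fun q => X q + X' q) Z =ᶠ[nhds p]
          fun q => g.nabla X Z q + g.nabla X' Z q := by
        filter_upwards [hE.isOpen.mem_nhds hp, hX.eventually, hX'.eventually, hZ.eventually]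
          with q hq h1 h2 h3 using (hE.tensorial_nabla hq h3).add X X' h1 h2
      rw [hE.nabla_congr hp hY (hXZ.add hXZ') (Filter.EventuallyEq.refl _ Y) h,
        hE.nabla_add_right hp hY hXZ hXZ']
    simp only [curvature, e1, e2, e3]
    module

theorem IsFrame.curvature_swap (hE : g.IsFrame U E s) {p : M} (hp : p ∈ U)
    {X Y Z : VField n M} (hX : SmoothFieldNear X p) (hY : SmoothFieldNear Y p)
    (hZ : SmoothFieldNear Z p) : g.curvature X Y Z p = -g.curvature Y X Z p := by
  have h : bracket X Y =ᶠ[nhds p] fun q => (-1 : ℝ) • bracket Y X q :=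
    Filter.Eventually.of_forall fun q =>
      (bracket_swap X Y q).trans (neg_one_smul ℝ (bracket Y X q)).symm
  have hc := smoothFnNear_const (n := n) (-1) p
  have hB := hY.bracket hX
  have e1 : g.nabla (bracket X Y) Z p = (-1 : ℝ) • g.nabla (bracket Y X) Z p := by
    rw [hE.nabla_congr hp (hB.smul hc) hZ h (Filter.EventuallyEq.refl _ Z)]
    exact (hE.tensorial_nabla hp hZ).smul _ _ hc hB
  simp only [curvature, e1]
  module

theorem IsFrame.tensorial_curvature_mid (hE : g.IsFrame U E s) {p : M} (hp : p ∈ U)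
    {X Z : VField n M} (hX : SmoothFieldNear X p) (hZ : SmoothFieldNear Z p) :
    TensorialNear (fun Y => g.curvature X Y Z p) p where
  smul f Y hf hY := by
    have := (hE.tensorial_curvature_left hp hX hZ).smul f Y hf hY
    rw [hE.curvature_swap hp hX (hY.smul hf) hZ, hE.curvature_swap hp hX hY hZ, this, smul_neg]
  add Y Y' hY hY' := by
    have := (hE.tensorial_curvature_left hp hX hZ).add Y Y' hY hY'
    rw [hE.curvature_swap hp hX (hY.add hY') hZ, hE.curvature_swap hp hX hY hZ,
      hE.curvature_swap hp hX hY' hZ, this, neg_add]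

/-- First derivatives of f cancel in pairs; the second derivatives leave X(Yf) − Y(Xf) − [X,Y]f,
which vanishes by `dirDeriv_bracket`. -/
theorem IsFrame.tensorial_curvature_right (hE : g.IsFrame U E s) {p : M} (hp : p ∈ U)
    {X Y : VField n M} (hX : SmoothFieldNear X p) (hY : SmoothFieldNear Y p) :
    TensorialNear (fun Z => g.curvature X Y Z p) p where
  smul f Z hf hZ := by
    have second : ∀ W W' : VField n M, SmoothFieldNear W p → SmoothFieldNear W' p →
        g.nabla W (g.nabla W' (fun q => f q • Z q)) p =
          dirDeriv (fun q => dirDeriv f q (W' q)) p (W p) • Z p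
            + dirDeriv f p (W' p) • g.nabla W Z p
            + (dirDeriv f p (W p) • g.nabla W' Z p + f p • g.nabla W (g.nabla W' Z) p) := by
      intro W W' hW hW'
      have h1 := hZ.smul (hf.dirDeriv hW')
      have h2 := hE.nabla_near hp hW' hZ
      rw [hE.nabla_congr hp hW (h1.add (h2.smul hf)) (Filter.EventuallyEq.refl _ W)
        (hE.nabla_eventuallyEq_smul_right hp hf hW' hZ),
        hE.nabla_add_right hp hW h1 (h2.smul hf), hE.nabla_smul_right hp (hf.dirDeriv hW') hW hZ,
        hE.nabla_smul_right hp hf hW h2]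
    simp only [curvature, second X Y hX hY, second Y X hY hX,
      hE.nabla_smul_right hp hf (hX.bracket hY) hZ, dirDeriv_bracket hf hX hY]
    module
  add Z Z' hZ hZ' := by
    have second : ∀ W W' : VField n M, SmoothFieldNear W p → SmoothFieldNear W' p →
        g.nabla W (g.nabla W' (fun q => Z q + Z' q)) p =
          g.nabla W (g.nabla W' Z) p + g.nabla W (g.nabla W' Z') p := by
      intro W W' hW hW'
      have h1 := hE.nabla_near hp hW' hZ
      have h2 := hE.nabla_near hp hW' hZ'
      have h : g.nabla W' (fun q => Z q + Z' q) =ᶠ[nhds p]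
          fun q => g.nabla W' Z q + g.nabla W' Z' q := by
        filter_upwards [hE.isOpen.mem_nhds hp, hW'.eventually, hZ.eventually, hZ'.eventually]
          with q hq h1 h2 h3 using hE.nabla_add_right hq h1 h2 h3
      rw [hE.nabla_congr hp hW (h1.add h2) (Filter.EventuallyEq.refl _ W) h,
        hE.nabla_add_right hp hW h1 h2]
    simp only [curvature, second X Y hX hY, second Y X hY hX,
      hE.nabla_add_right hp (hX.bracket hY) hZ hZ']
    module

theorem IsFrame.tensorial_pointwise {A : Type*} [AddCommGroup A] [Module ℝ A]
    {Φ : VField n M → A} (hE : g.IsFrame U E s) {p : M} (hp : p ∈ U) (hΦ : TensorialNear Φ p)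
    {X Y : VField n M} (hX : SmoothFieldNear X p) (hY : SmoothFieldNear Y p) (h : X p = Y p) :
    Φ X = Φ Y := by
  rw [hE.tensorial hp hΦ hX, hE.tensorial hp hΦ hY, h]

/-- Tensoriality in each slot makes the arbitrary extensions in `curvatureAt` irrelevant, so frame
fields may be used instead. -/
theorem IsFrame.curvatureAt_eq (hE : g.IsFrame U E s) {p : M} (hp : p ∈ U)
    {X Y Z : VField n M} (hX : SmoothFieldNear X p) (hY : SmoothFieldNear Y p)
    (hZ : SmoothFieldNear Z p) :
    g.curvatureAt p (X p) (Y p) (Z p) = g.curvature X Y Z p := by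
  have hX' := smoothFieldNear_extendVec (X p)
  have hY' := smoothFieldNear_extendVec (Y p)
  have hZ' := smoothFieldNear_extendVec (Z p)
  rw [curvatureAt, hE.tensorial_pointwise hp (hE.tensorial_curvature_left hp hY' hZ') hX' hX
      (extendVec_self _),
    hE.tensorial_pointwise hp (hE.tensorial_curvature_mid hp hX hZ') hY' hY (extendVec_self _),
    hE.tensorial_pointwise hp (hE.tensorial_curvature_right hp hX hY) hZ' hZ (extendVec_self _)]

theorem IsFrame.curvatureAt_left (hE : g.IsFrame U E s) {p : M} (hp : p ∈ U)
    (u v w : TangentSpace (𝓡 n) p) : g.curvatureAt p u v w =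
      ∑ i, (s i * g.val p u (E i p)) • g.curvatureAt p (E i p) v w := by
  have hv := smoothFieldNear_extendVec v
  have hw := smoothFieldNear_extendVec w
  have h := hE.tensorial hp (hE.tensorial_curvature_left hp hv hw) (smoothFieldNear_extendVec u)
  rw [curvatureAt, h, extendVec_self]
  refine Finset.sum_congr rfl fun i _ => ?_
  rw [← hE.curvatureAt_eq hp (hE.near hp i) hv hw, extendVec_self, extendVec_self]

theorem IsFrame.curvatureAt_mid (hE : g.IsFrame U E s) {p : M} (hp : p ∈ U)
    (u v w : TangentSpace (𝓡 n) p) : g.curvatureAt p u v w =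
      ∑ i, (s i * g.val p v (E i p)) • g.curvatureAt p u (E i p) w := by
  have hu := smoothFieldNear_extendVec u
  have hw := smoothFieldNear_extendVec w
  have h := hE.tensorial hp (hE.tensorial_curvature_mid hp hu hw) (smoothFieldNear_extendVec v)
  rw [curvatureAt, h, extendVec_self]
  refine Finset.sum_congr rfl fun i _ => ?_
  rw [← hE.curvatureAt_eq hp hu (hE.near hp i) hw, extendVec_self, extendVec_self]

theorem IsFrame.curvatureAt_right (hE : g.IsFrame U E s) {p : M} (hp : p ∈ U)
    (u v w : TangentSpace (𝓡 n) p) : g.curvatureAt p u v w =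
      ∑ i, (s i * g.val p w (E i p)) • g.curvatureAt p u v (E i p) := by
  have hu := smoothFieldNear_extendVec u
  have hv := smoothFieldNear_extendVec v
  have h := hE.tensorial hp (hE.tensorial_curvature_right hp hu hv) (smoothFieldNear_extendVec w)
  rw [curvatureAt, h, extendVec_self]
  refine Finset.sum_congr rfl fun i _ => ?_
  rw [← hE.curvatureAt_eq hp hu hv (hE.near hp i), extendVec_self, extendVec_self]

/-- The Ricci tensor as a trace in a frame. -/
theorem IsFrame.ricci_eq (hE : g.IsFrame U E s) {p : M} (hp : p ∈ U)
    (u v : TangentSpace (𝓡 n) p) :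
    g.ricci p u v = ∑ i, s i * g.val p (g.curvatureAt p u (E i p) v) (E i p) := by
  let L : TangentSpace (𝓡 n) p →ₗ[ℝ] TangentSpace (𝓡 n) p :=
    { toFun := fun x => g.curvatureAt p u x v
      map_add' := fun x y => by
        rw [hE.curvatureAt_mid hp u (x + y), hE.curvatureAt_mid hp u x, hE.curvatureAt_mid hp u y,
          ← Finset.sum_add_distrib]
        refine Finset.sum_congr rfl fun i _ => ?_
        rw [← add_smul, map_add, add_apply, mul_add]
      map_smul' := fun c x => by
        rw [hE.curvatureAt_mid hp u (c • x), hE.curvatureAt_mid hp u x, RingHom.id_apply,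
          Finset.smul_sum]
        refine Finset.sum_congr rfl fun i _ => ?_
        rw [smul_smul, map_smul, smul_apply, smul_eq_mul]
        congr 1
        ring }
  -- A trace does not depend on the basis: it is defined in the standard one and evaluated in the
  -- frame.
  have h1 : g.ricci p u v = LinearMap.trace ℝ _ L := by
    rw [LinearMap.trace_eq_matrix_trace ℝ (tangentBasis p), Matrix.trace]
    refine Finset.sum_congr rfl fun i _ => ?_
    rw [Matrix.diag_apply, LinearMap.toMatrix_apply]
    rfl
  rw [h1, LinearMap.trace_eq_matrix_trace ℝ (hE.basis hp), Matrix.trace]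
  refine Finset.sum_congr rfl fun i _ => ?_
  rw [Matrix.diag_apply, LinearMap.toMatrix_apply, hE.basis_repr, hE.basis_apply]
  rfl

theorem IsFrame.ricci_left (hE : g.IsFrame U E s) {p : M} (hp : p ∈ U)
    (u v : TangentSpace (𝓡 n) p) :
    g.ricci p u v = ∑ i, (s i * g.val p u (E i p)) * g.ricci p (E i p) v := by
  simp only [hE.ricci_eq hp]
  simp only [hE.curvatureAt_left hp u, val_sum_left, Finset.mul_sum, map_smul, smul_apply,
    smul_eq_mul]
  rw [Finset.sum_comm]
  exact Finset.sum_congr rfl fun i _ => Finset.sum_congr rfl fun j _ => by ring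

theorem IsFrame.ricci_right (hE : g.IsFrame U E s) {p : M} (hp : p ∈ U)
    (u v : TangentSpace (𝓡 n) p) :
    g.ricci p u v = ∑ i, (s i * g.val p v (E i p)) * g.ricci p u (E i p) := by
  simp only [hE.ricci_eq hp]
  simp only [hE.curvatureAt_right hp _ _ v, val_sum_left, Finset.mul_sum, map_smul, smul_apply,
    smul_eq_mul]
  rw [Finset.sum_comm]
  exact Finset.sum_congr rfl fun i _ => Finset.sum_congr rfl fun j _ => by ring

/-- Both the standard basis paired with its g-dual and the frame weighted by its signs represent the
inverse metric; `h` below is this comparison. -/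
theorem IsFrame.scalar_eq (hE : g.IsFrame U E s) {p : M} (hp : p ∈ U) :
    g.scalar p = ∑ i, s i * g.ricci p (E i p) (E i p) := by
  have h : ∀ k l, ∑ i, g.val p (tangentBasis p i) (E k p) * g.val p (g.dualBasis p i) (E l p) =
      if k = l then s k else 0 := by
    intro k l
    have h := congrArg (fun v => g.val p v (E l p)) (sum_val_smul_dualBasis (g := g) p (E k p))
    simp only [val_sum_left, map_smul, smul_apply, smul_eq_mul] at h
    rw [h, hE.val_frame hp]
  have h2 : ∀ i, g.ricci p (tangentBasis p i) (g.dualBasis p i) =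
      ∑ k, ∑ l, (s k * s l * g.ricci p (E k p) (E l p)) *
        (g.val p (tangentBasis p i) (E k p) * g.val p (g.dualBasis p i) (E l p)) := by
    intro i
    rw [hE.ricci_left hp]
    refine Finset.sum_congr rfl fun k _ => ?_
    rw [hE.ricci_right hp, Finset.mul_sum]
    exact Finset.sum_congr rfl fun l _ => by ring
  simp only [scalar, h2]
  rw [Finset.sum_comm]
  refine Finset.sum_congr rfl fun k _ => ?_
  rw [Finset.sum_comm]
  simp only [← Finset.mul_sum, h, mul_ite, mul_zero, Finset.sum_ite_eq, Finset.mem_univ, if_true]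
  linear_combination (s k * g.ricci p (E k p) (E k p)) * hE.sign k

/-- The curvature of a frame whose covariant derivatives and brackets are known. -/
theorem IsFrame.curvature_frame (hE : g.IsFrame U E s) {Γ C : Fin n → Fin n → Fin n → M → ℝ}
    (hΓ : ∀ p ∈ U, ∀ i j k, SmoothFnNear (n := n) (Γ i j k) p)
    (hC : ∀ p ∈ U, ∀ i j k, SmoothFnNear (n := n) (C i j k) p)
    (hnabla : ∀ p ∈ U, ∀ i j, g.nabla (E i) (E j) p = ∑ k, Γ i j k p • E k p)
    (hbracket : ∀ p ∈ U, ∀ i j, bracket (E i) (E j) p = ∑ k, C i j k p • E k p)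
    {p : M} (hp : p ∈ U) (i j k : Fin n) :
    g.curvature (E i) (E j) (E k) p = ∑ l, (∑ m, C i j m p * Γ m k l p
      - (dirDeriv (Γ j k l) p (E i p) + ∑ m, Γ j k m p * Γ i m l p)
      + (dirDeriv (Γ i k l) p (E j p) + ∑ m, Γ i k m p * Γ j m l p)) • E l p := by
  have e1 : g.nabla (bracket (E i) (E j)) (E k) p =
      ∑ l, (∑ m, C i j m p * Γ m k l p) • E l p := by
    have hm : ∀ m ∈ Finset.univ, SmoothFieldNear (fun q => C i j m q • E m q) p :=
      fun m _ => (hE.near hp m).smul (hC p hp i j m)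
    have heq : bracket (E i) (E j) =ᶠ[nhds p] fun q => ∑ m, C i j m q • E m q := by
      filter_upwards [hE.isOpen.mem_nhds hp] with q hq using hbracket q hq i j
    rw [hE.nabla_congr hp (SmoothFieldNear.sum hm) (hE.near hp k) heq
      (Filter.EventuallyEq.refl _ _), (hE.tensorial_nabla hp (hE.near hp k)).sum hm]
    simp only [(hE.tensorial_nabla hp (hE.near hp k)).smul _ _ (hC p hp i j _) (hE.near hp _),
      hnabla p hp, Finset.smul_sum, Finset.sum_smul, smul_smul]
    rw [Finset.sum_comm]
  have e2 : ∀ i j, g.nabla (E i) (g.nabla (E j) (E k)) p =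
      ∑ l, (dirDeriv (Γ j k l) p (E i p) + ∑ m, Γ j k m p * Γ i m l p) • E l p := by
    intro i j
    have hm : ∀ m, SmoothFieldNear (fun q => Γ j k m q • E m q) p :=
      fun m => (hE.near hp m).smul (hΓ p hp j k m)
    have heq : g.nabla (E j) (E k) =ᶠ[nhds p] fun q => ∑ m, Γ j k m q • E m q := by
      filter_upwards [hE.isOpen.mem_nhds hp] with q hq using hnabla q hq j k
    have hsum : ∀ t : Finset (Fin n), g.nabla (E i) (fun q => ∑ m ∈ t, Γ j k m q • E m q) p =
        ∑ m ∈ t, g.nabla (E i) (fun q => Γ j k m q • E m q) p := by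
      intro t
      induction t using Finset.induction_on with
      | empty =>
        have h0 := hE.nabla_smul_right hp (smoothFnNear_const 0 p) (hE.near hp i) (hE.near hp k)
        simpa using h0
      | insert a t ha ih =>
        simp only [Finset.sum_insert ha]
        rw [hE.nabla_add_right hp (hE.near hp i) (hm a) (SmoothFieldNear.sum fun m _ => hm m), ih]
    rw [hE.nabla_congr hp (hE.near hp i) (SmoothFieldNear.sum fun m _ => hm m)
      (Filter.EventuallyEq.refl _ _) heq, hsum]
    simp only [hE.nabla_smul_right hp (hΓ p hp j k _) (hE.near hp i) (hE.near hp _),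
      hnabla p hp, Finset.smul_sum, Finset.sum_smul, smul_smul, add_smul, Finset.sum_add_distrib]
    rw [Finset.sum_comm (f := fun l m => (Γ j k m p * Γ i m l p) • E l p)]
  rw [curvature, e1, e2 i j, e2 j i, ← Finset.sum_sub_distrib, ← Finset.sum_sub_distrib]
  refine Finset.sum_congr rfl fun l _ => ?_
  rw [← sub_smul, ← sub_smul]
  congr 1
  ring

theorem IsFrame.coeff_eq (hE : g.IsFrame U E s) {p : M} (hp : p ∈ U) {c d : Fin n → ℝ}
    (h : ∑ i, c i • E i p = ∑ i, d i • E i p) (i : Fin n) : c i = d i := by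
  have h1 := congrArg (fun v => g.val p v (E i p)) h
  simp only [hE.val_sum_smul hp] at h1
  linear_combination s i * h1 + (d i - c i) * hE.sign i

/-- Iterated brackets of a frame with known brackets. -/
theorem IsFrame.bracket_bracket (hE : g.IsFrame U E s) {C : Fin n → Fin n → Fin n → M → ℝ}
    (hC : ∀ p ∈ U, ∀ i j k, SmoothFnNear (n := n) (C i j k) p)
    (hbracket : ∀ p ∈ U, ∀ i j, bracket (E i) (E j) p = ∑ k, C i j k p • E k p)
    {p : M} (hp : p ∈ U) (i j k : Fin n) :
    bracket (E i) (bracket (E j) (E k)) p =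
      ∑ l, (dirDeriv (C j k l) p (E i p) + ∑ m, C j k m p * C i m l p) • E l p := by
  have hm : ∀ m, SmoothFieldNear (fun q => C j k m q • E m q) p :=
    fun m => (hE.near hp m).smul (hC p hp j k m)
  have heq : bracket (E j) (E k) =ᶠ[nhds p] fun q => ∑ m, C j k m q • E m q := by
    filter_upwards [hE.isOpen.mem_nhds hp] with q hq using hbracket q hq j k
  have hsum : ∀ t : Finset (Fin n), bracket (E i) (fun q => ∑ m ∈ t, C j k m q • E m q) p =
      ∑ m ∈ t, bracket (E i) (fun q => C j k m q • E m q) p := by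
    intro t
    induction t using Finset.induction_on with
    | empty =>
      have h0 := bracket_smul_right (X := E i) (smoothFnNear_const 0 p).at (hE.near hp k).at
      simpa using h0
    | insert a t ha ih =>
      simp only [Finset.sum_insert ha]
      rw [bracket_add_right (hm a).at (SmoothFieldNear.sum fun m _ => hm m).at, ih]
  refine (bracket_congr (Filter.EventuallyEq.refl _ (E i)) heq).trans ((hsum _).trans ?_)
  simp only [bracket_smul_right (hC p hp j k _).at (hE.near hp _).at,
    hbracket p hp, Finset.smul_sum, Finset.sum_smul, smul_smul, add_smul, Finset.sum_add_distrib]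
  rw [Finset.sum_comm (f := fun l m => (C j k m p * C i m l p) • E l p)]

/-- The Jacobi identity in a frame. -/
theorem IsFrame.jacobi (hE : g.IsFrame U E s) {C : Fin n → Fin n → Fin n → M → ℝ}
    (hC : ∀ p ∈ U, ∀ i j k, SmoothFnNear (n := n) (C i j k) p)
    (hbracket : ∀ p ∈ U, ∀ i j, bracket (E i) (E j) p = ∑ k, C i j k p • E k p)
    {p : M} (hp : p ∈ U) (i j k l : Fin n) :
    dirDeriv (C j k l) p (E i p) + ∑ m, C j k m p * C i m l p =
      -(dirDeriv (C i j l) p (E k p) + ∑ m, C i j m p * C k m l p)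
      + (dirDeriv (C i k l) p (E j p) + ∑ m, C i k m p * C j m l p) := by
  have h := bracket_leibniz (hE.near hp i).at (hE.near hp j).at (hE.near hp k).at
  rw [bracket_swap (bracket (E i) (E j)), hE.bracket_bracket hC hbracket hp,
    hE.bracket_bracket hC hbracket hp, hE.bracket_bracket hC hbracket hp,
    ← Finset.sum_neg_distrib, ← Finset.sum_add_distrib] at h
  simp only [← neg_smul, ← add_smul] at h
  exact hE.coeff_eq hp h l

/-- The covariant derivatives of a frame with known brackets. -/
theorem IsFrame.nabla_frame (hE : g.IsFrame U E s) {C : Fin n → Fin n → Fin n → M → ℝ}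
    (hbracket : ∀ p ∈ U, ∀ i j, bracket (E i) (E j) p = ∑ k, C i j k p • E k p)
    {p : M} (hp : p ∈ U) (i j : Fin n) :
    g.nabla (E i) (E j) p = ∑ k, (s k * (C i j k p * s k - C i k j p * s j - C j k i p * s i) / 2)
      • E k p := by
  -- Products of frame fields are constant on U, so only the bracket terms of Koszul's formula
  -- survive.
  have hconst : ∀ i j k, dirDeriv (fun q => g.val q (E i q) (E j q)) p (E k p) = 0 := by
    intro i j k
    have : (fun q => g.val q (E i q) (E j q)) =ᶠ[nhds p] fun _ => if i = j then s i else 0 := by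
      filter_upwards [hE.isOpen.mem_nhds hp] with q hq using hE.val_frame hq i j
    rw [dirDeriv_congr this, dirDeriv_const]
  rw [hE.nabla_eq hp (hE.near hp i) (hE.near hp j)]
  refine Finset.sum_congr rfl fun k _ => ?_
  simp only [koszul, hconst, hbracket p hp, hE.val_sum_smul hp]
  congr 1
  ring

end Curvature

end PseudoMetric

/-! ### Existence of φ-bases and the bracket relations forced by normality -/

namespace AlmostParacontactMetric

variable {M : Type*} [TopologicalSpace M] [ChartedSpace (Model 3) M] [IsManifold (𝓡 3) ∞ M]
  (S : AlmostParacontactMetric M)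

theorem eta_eq (p : M) (v : TangentSpace (𝓡 3) p) : S.eta p v = S.g.val p v (S.xi p) := by
  have h := S.compatible p v (S.xi p)
  rw [S.phi_xi, map_zero, S.eta_xi] at h
  linarith

theorem val_xi_left (p : M) (v : TangentSpace (𝓡 3) p) : S.g.val p (S.xi p) v = S.eta p v := by
  rw [S.eta_eq, S.g.symm]

theorem val_phi_self (p : M) {v : TangentSpace (𝓡 3) p} (hv : S.eta p v = 0) :
    S.g.val p v (S.phi p v) = 0 := by
  have h := S.compatible p v (S.phi p v)
  rw [S.phi_sq, hv, zero_smul, sub_zero, zero_mul, add_zero, S.g.symm] at h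
  linarith

theorem smoothFieldAt_phiField {X : VField 3 M} {p : M} (hX : SmoothFieldAt X p) :
    SmoothFieldAt (S.phiField X) p :=
  ContMDiffAt.clm_bundle_apply S.phi_smooth.contMDiffAt hX

theorem smoothFieldNear_phiField {X : VField 3 M} {p : M} (hX : SmoothFieldNear X p) :
    SmoothFieldNear (S.phiField X) p := by
  filter_upwards [hX] with q hq using S.smoothFieldAt_phiField hq

theorem smoothFieldNear_xi (p : M) : SmoothFieldNear S.xi p :=
  S.xi_smooth.near isOpen_univ (Set.mem_univ p)

/-- The vector fields `ξ, e, φe`. -/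
noncomputable def frame (e : VField 3 M) : Fin 3 → VField 3 M := ![S.xi, e, S.phiField e]

/-- The signs of a `φ`-basis. -/
noncomputable def frameSign : Fin 3 → ℝ := ![1, 1, -1]

variable {S}

theorem IsPhiBasis.isFrame {e : VField 3 M} {U : Set M} (h : S.IsPhiBasis e U) (hU : IsOpen U) :
    S.g.IsFrame U (S.frame e) frameSign where
  isOpen := hU
  smooth i := by
    fin_cases i
    · exact fun p _ => (S.xi_smooth p (Set.mem_univ p)).mono (Set.subset_univ _)
    · exact h.smooth
    · exact fun p hp => (S.smoothFieldAt_phiField (h.smooth.at hU hp)).contMDiffWithinAt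
  sign i := by fin_cases i <;> simp [frameSign]
  val_self p hp i := by
    fin_cases i
    · exact h.xi_xi p hp
    · exact h.e_e p hp
    · exact h.phi_phi p hp
  val_ne p hp i j hij := by
    fin_cases i <;> fin_cases j <;> first | exact absurd rfl hij | skip
    · exact h.xi_e p hp
    · exact h.xi_phi p hp
    · exact (S.g.symm _ _ _).trans (h.xi_e p hp)
    · exact h.e_phi p hp
    · exact (S.g.symm _ _ _).trans (h.xi_phi p hp)
    · exact (S.g.symm _ _ _).trans (h.e_phi p hp)

theorem IsPhiBasis.eta_e {e : VField 3 M} {U : Set M} (h : S.IsPhiBasis e U) {p : M}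
    (hp : p ∈ U) : S.eta p (e p) = 0 := by
  rw [← S.val_xi_left]
  exact h.xi_e p hp

variable (S) in
-- For X = ξ and η(Y) = 0 the normality condition collapses, because φξ = 0, to φ²[ξ,Y] − φ[ξ,φY] +
-- η([ξ,Y])ξ = 0. Its η-component gives the first claim, and φ² = Id on ker η the second.
theorem bracket_xi_of_isNormal (hS : S.IsNormal) {Y : VField 3 M} {p : M}
    (hY : SmoothFieldAt Y p) (h : ∀ᶠ q in nhds p, S.eta q (Y q) = 0) :
    S.eta p (bracket S.xi Y p) = 0 ∧
      bracket S.xi Y p = S.phi p (bracket S.xi (S.phiField Y) p) := by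
  have hN := hS p S.xi Y (S.smoothFieldNear_xi p).at hY
  have h0 : S.phiField S.xi = 0 := by
    funext q
    exact S.phi_xi q
  have hd : S.dEta S.xi Y p = -S.eta p (bracket S.xi Y p) / 2 := by
    have h1 : dirDeriv (fun q => S.eta q (Y q)) p (S.xi p) = 0 := by
      rw [dirDeriv_congr (h := fun _ => 0) h, dirDeriv_const]
    have h2 : dirDeriv (fun q => S.eta q (S.xi q)) p (Y p) = 0 := by
      simp only [S.eta_xi, dirDeriv_const]
    simp only [dEta, h1, h2]
    ring
  have hb : ∀ W : VField 3 M, bracket (0 : VField 3 M) W p = 0 := fun W => by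
    simp [bracket]
  simp only [nijenhuis, h0, hb, map_zero, add_zero, sub_zero, hd] at hN
  have h1 := congrArg (S.eta p) hN
  simp only [map_sub, map_smul, S.eta_phi, S.eta_xi, map_zero, smul_eq_mul] at h1
  have h2 : S.eta p (bracket S.xi Y p) = 0 := by linarith
  refine ⟨h2, ?_⟩
  rw [S.phi_sq, h2] at hN
  simpa [sub_eq_zero] using hN

theorem IsPhiBasis.exists_localDescription (hS : S.IsNormal) {e : VField 3 M} {U : Set M}
    (h : S.IsPhiBasis e U) (hU : IsOpen U) :
    ∃ b₁ b₂ a₃ a₄ a₅ : M → ℝ, S.IsLocalDescription U e b₁ b₂ a₃ a₄ a₅ := by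
  have hE := h.isFrame hU
  have hxi := S.smoothFieldNear_xi
  have he : ∀ p ∈ U, SmoothFieldNear e p := fun p hp => h.smooth.near hU hp
  have hφe : ∀ p ∈ U, SmoothFieldNear (S.phiField e) p :=
    fun p hp => S.smoothFieldNear_phiField (he p hp)
  have hsm : ∀ X Y Z : VField 3 M, (∀ p ∈ U, SmoothFieldNear X p) → (∀ p ∈ U, SmoothFieldNear Y p) →
      (∀ p ∈ U, SmoothFieldNear Z p) → ∀ p ∈ U,
      SmoothFnNear (n := 3) (fun q => S.g.val q (bracket X Y q) (Z q)) p :=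
    fun X Y Z hX hY hZ p hp => S.g.smoothFnNear_val ((hX p hp).bracket (hY p hp)) (hZ p hp)
  have on : ∀ f : M → ℝ, (∀ p ∈ U, SmoothFnNear (n := 3) f p) →
      ContMDiffOn (𝓡 3) 𝓘(ℝ, ℝ) ∞ f U := fun f hf p hp => (hf p hp).at.contMDiffWithinAt
  let β : M → ℝ := fun q => S.g.val q (bracket S.xi e q) (e q)
  let α : M → ℝ := fun q => S.g.val q (bracket S.xi e q) (S.phiField e q)
  let x : M → ℝ := fun q => S.g.val q (bracket e (S.phiField e) q) (S.xi q)
  let y : M → ℝ := fun q => S.g.val q (bracket e (S.phiField e) q) (e q)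
  let z : M → ℝ := fun q => S.g.val q (bracket e (S.phiField e) q) (S.phiField e q)
  have hβ := hsm S.xi e e (fun p _ => hxi p) he he
  have hα := hsm S.xi e _ (fun p _ => hxi p) he hφe
  have hx := hsm e _ S.xi he hφe (fun p _ => hxi p)
  have hy := hsm e _ e he hφe he
  have hz := hsm e _ _ he hφe hφe
  have hc := smoothFnNear_const (n := 3) (M := M) (1 / 2)
  have key : ∀ p ∈ U, bracket S.xi e p = β p • e p - α p • S.phi p (e p) ∧
      bracket S.xi (S.phiField e) p = β p • S.phi p (e p) - α p • e p := by
    intro p hp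
    have h1 := S.bracket_xi_of_isNormal hS (he p hp).at
      (Filter.eventually_of_mem (hU.mem_nhds hp) fun q hq => h.eta_e hq)
    -- Taking Y = φe, with φ²e = e on U, gives [ξ, φe] = φ[ξ, e]; so the two coefficients of [ξ, e]
    -- also determine [ξ, φe].
    have h2 := S.bracket_xi_of_isNormal hS (hφe p hp).at
      (Filter.Eventually.of_forall fun q => S.eta_phi q _)
    have hee : bracket S.xi (S.phiField (S.phiField e)) p = bracket S.xi e p := by
      refine bracket_congr (Filter.EventuallyEq.refl _ _) ?_
      filter_upwards [hU.mem_nhds hp] with q hq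
      rw [phiField, phiField, S.phi_sq, h.eta_e hq, zero_smul, sub_zero]
    rw [hee] at h2
    have h3 : bracket S.xi e p = β p • e p - α p • S.phi p (e p) := by
      have h4 := hE.expand hp (bracket S.xi e p)
      simp only [Fin.sum_univ_three, frame, frameSign, Matrix.cons_val] at h4
      rw [← S.eta_eq, h1.1] at h4
      rw [h4]
      simp only [β, α, phiField]
      module
    refine ⟨h3, ?_⟩
    rw [h2.2, h3, map_sub, map_smul, map_smul, S.phi_sq, h.eta_e hp, zero_smul, sub_zero]
  -- Since φe is time-like, coefficients along it are minus the scalar products: a₃ − b₂ = −α, and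
  -- −a₅ = −z. The choice of a₃ only serves to produce this difference.
  refine ⟨fun q => -β q, fun q => x q * (1 / 2), fun q => -α q + x q * (1 / 2), y, z,
    hU, h, on _ fun p hp => (hβ p hp).neg, on _ fun p hp => (hx p hp).mul (hc p),
    on _ fun p hp => (hα p hp).neg.add ((hx p hp).mul (hc p)), on _ hy, on _ hz, ?_, ?_, ?_⟩
  · intro p hp
    rw [(key p hp).1]
    module
  · intro p hp
    rw [(key p hp).2]
    module
  · intro p hp
    have h4 := hE.expand hp (bracket e (S.phiField e) p)
    simp only [Fin.sum_univ_three, frame, frameSign, Matrix.cons_val] at h4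
    rw [h4]
    simp only [x, y, z, phiField]
    module

variable (S) in
-- The map φ² is the projection onto ker η. If g were null on all of ker η, polarization would make
-- g zero there; as ξ is orthogonal to ker η, nondegeneracy would give φ² = 0, and the tangent space
-- would be spanned by ξ alone.
theorem exists_horizontal_ne (p : M) :
    ∃ u : TangentSpace (𝓡 3) p, S.g.val p (S.phi p (S.phi p u)) (S.phi p (S.phi p u)) ≠ 0 := by
  by_contra hcon
  push Not at hcon
  have hzero : ∀ u : TangentSpace (𝓡 3) p, S.phi p (S.phi p u) = 0 := by
    intro u
    refine S.g.nondegenerate p _ fun v => ?_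
    have h1 := hcon (u + v)
    have h2 := hcon u
    have h3 := hcon v
    simp only [map_add, add_apply] at h1
    have h4 := S.g.symm p (S.phi p (S.phi p u)) (S.phi p (S.phi p v))
    have h5 : S.g.val p (S.phi p (S.phi p u)) (S.phi p (S.phi p v)) = 0 := by linarith
    have h6 : v = S.phi p (S.phi p v) + S.eta p v • S.xi p := by rw [S.phi_sq]; simp
    rw [h6, map_add, map_smul, h5, ← S.eta_eq, S.eta_phi]
    simp
  have hle : Module.finrank ℝ (TangentSpace (𝓡 3) p) ≤ 1 := by
    refine finrank_le_one (S.xi p) fun w => ⟨S.eta p w, ?_⟩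
    have := hzero w
    rw [S.phi_sq, sub_eq_zero] at this
    exact this.symm
  have h3 : Module.finrank ℝ (TangentSpace (𝓡 3) p) = 3 :=
    finrank_euclideanSpace_fin (𝕜 := ℝ) (n := 3)
  omega

variable (S) in
-- A horizontal non-null vector may be taken space-like, because φ reverses the sign of the norm on
-- ker η. Extending it through φ² (or φ³) keeps it horizontal, and it is normalised where its norm
-- stays positive.
theorem exists_isPhiBasis (p : M) :
    ∃ (U : Set M) (e : VField 3 M), IsOpen U ∧ p ∈ U ∧ S.IsPhiBasis e U := by
  have hY : ∃ Y : VField 3 M, SmoothFieldNear Y p ∧ (∀ q, S.eta q (Y q) = 0) ∧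
      0 < S.g.val p (Y p) (Y p) := by
    obtain ⟨u, hu⟩ := S.exists_horizontal_ne p
    have hX := S.smoothFieldNear_phiField
      (S.smoothFieldNear_phiField (smoothFieldNear_extendVec u))
    have hXp : S.phiField (S.phiField (extendVec u)) p = S.phi p (S.phi p u) := by
      simp [phiField]
    rcases lt_or_gt_of_ne hu with hneg | hpos
    · refine ⟨_, S.smoothFieldNear_phiField hX, fun q => S.eta_phi q _, ?_⟩
      have h := S.compatible p (S.phi p (S.phi p u)) (S.phi p (S.phi p u))
      rw [S.eta_phi, zero_mul, add_zero] at h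
      rw [phiField, hXp, h]
      linarith
    · exact ⟨_, hX, fun q => S.eta_phi q _, by rw [hXp]; exact hpos⟩
  obtain ⟨Y, hYs, hYη, hYp⟩ := hY
  let N : M → ℝ := fun q => S.g.val q (Y q) (Y q)
  have hN : SmoothFnNear (n := 3) N p := S.g.smoothFnNear_val hYs hYs
  have hev : ∀ᶠ q in nhds p, SmoothFieldAt Y q ∧ 0 < N q :=
    hYs.and (hN.at.continuousAt.eventually (lt_mem_nhds hYp))
  obtain ⟨U, hUs, hUo, hpU⟩ := mem_nhds_iff.1 hev
  have hη : ∀ q, S.eta q ((Real.sqrt (N q))⁻¹ • Y q) = 0 := fun q => by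
    rw [map_smul, hYη, smul_zero]
  have hee : ∀ q ∈ U, S.g.val q ((Real.sqrt (N q))⁻¹ • Y q) ((Real.sqrt (N q))⁻¹ • Y q) = 1 := by
    intro q hq
    have hpos := (hUs hq).2
    have hs := Real.sqrt_pos.2 hpos
    rw [map_smul, map_smul, smul_apply, smul_eq_mul, smul_eq_mul]
    change (Real.sqrt (N q))⁻¹ * ((Real.sqrt (N q))⁻¹ * N q) = 1
    nth_rewrite 3 [← Real.mul_self_sqrt hpos.le]
    field_simp
  refine ⟨U, fun q => (Real.sqrt (N q))⁻¹ • Y q, hUo, hpU, ?_, ?_, hee, ?_, ?_, ?_, ?_⟩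
  · intro q hq
    obtain ⟨h1, h2⟩ := hUs hq
    have hNq : SmoothFnAt (n := 3) N q := S.g.smoothFnAt_val h1 h1
    have hf : ContDiffAt ℝ ∞ (fun t : ℝ => (Real.sqrt t)⁻¹) (N q) :=
      (Real.contDiffAt_sqrt h2.ne').inv (Real.sqrt_pos.2 h2).ne'
    exact (SmoothFieldAt.smul (hf.contMDiffAt.comp q hNq) h1).contMDiffWithinAt
  · intro q _
    rw [S.val_xi_left, S.eta_xi]
  · intro q hq
    rw [S.compatible, hη, hee q hq]
    simp
  · intro q _
    rw [S.val_xi_left, hη]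
  · intro q _
    rw [S.val_xi_left, S.eta_phi]
  · intro q _
    exact S.val_phi_self q (hη q)

theorem exists_localDescription (hS : S.IsNormal) (p : M) :
    ∃ (U : Set M) (e : VField 3 M) (b₁ b₂ a₃ a₄ a₅ : M → ℝ),
      p ∈ U ∧ S.IsLocalDescription U e b₁ b₂ a₃ a₄ a₅ := by
  obtain ⟨U, e, hU, hp, h⟩ := S.exists_isPhiBasis p
  obtain ⟨b₁, b₂, a₃, a₄, a₅, hd⟩ := h.exists_localDescription hS hU
  exact ⟨U, e, b₁, b₂, a₃, a₄, a₅, hp, hd⟩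

end AlmostParacontactMetric

/-! ### Structure functions: connection, Jacobi identities and Ricci components -/

namespace AlmostParacontactMetric

variable {M : Type*} [TopologicalSpace M] [ChartedSpace (Model 3) M] [IsManifold (𝓡 3) ∞ M]
  {S : AlmostParacontactMetric M}

/-- The structure functions of the frame `ξ, e, φe`. -/
def bracketCoeff (b₁ b₂ a₃ a₄ a₅ : M → ℝ) : Fin 3 → Fin 3 → Fin 3 → M → ℝ :=
  ![![![fun _ => 0, fun _ => 0, fun _ => 0],
      ![fun _ => 0, fun q => -b₁ q, fun q => a₃ q - b₂ q],
      ![fun _ => 0, fun q => a₃ q - b₂ q, fun q => -b₁ q]],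
    ![![fun _ => 0, fun q => b₁ q, fun q => -(a₃ q - b₂ q)],
      ![fun _ => 0, fun _ => 0, fun _ => 0],
      ![fun q => 2 * b₂ q, fun q => a₄ q, fun q => -a₅ q]],
    ![![fun _ => 0, fun q => -(a₃ q - b₂ q), fun q => b₁ q],
      ![fun q => -(2 * b₂ q), fun q => -a₄ q, fun q => a₅ q],
      ![fun _ => 0, fun _ => 0, fun _ => 0]]]

/-- The connection coefficients of the frame `ξ, e, φe`. -/
def connCoeff (b₁ b₂ a₃ a₄ a₅ : M → ℝ) : Fin 3 → Fin 3 → Fin 3 → M → ℝ :=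
  ![![![fun _ => 0, fun _ => 0, fun _ => 0],
      ![fun _ => 0, fun _ => 0, fun q => a₃ q],
      ![fun _ => 0, fun q => a₃ q, fun _ => 0]],
    ![![fun _ => 0, fun q => b₁ q, fun q => b₂ q],
      ![fun q => -b₁ q, fun _ => 0, fun q => a₄ q],
      ![fun q => b₂ q, fun q => a₄ q, fun _ => 0]],
    ![![fun _ => 0, fun q => b₂ q, fun q => b₁ q],
      ![fun q => -b₂ q, fun _ => 0, fun q => a₅ q],
      ![fun q => b₁ q, fun q => a₅ q, fun _ => 0]]]

namespace IsLocalDescription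

variable {U : Set M} {e : VField 3 M} {b₁ b₂ a₃ a₄ a₅ : M → ℝ}

theorem isFrame (h : S.IsLocalDescription U e b₁ b₂ a₃ a₄ a₅) :
    S.g.IsFrame U (S.frame e) frameSign := h.phiBasis.isFrame h.isOpen

theorem near_of_contMDiffOn (h : S.IsLocalDescription U e b₁ b₂ a₃ a₄ a₅) {f : M → ℝ}
    (hf : ContMDiffOn (𝓡 3) 𝓘(ℝ, ℝ) ∞ f U) {p : M} (hp : p ∈ U) :
    SmoothFnNear (n := 3) f p := by
  filter_upwards [h.isOpen.mem_nhds hp] with q hq using hf.contMDiffAt (h.isOpen.mem_nhds hq)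

theorem smooth_bracketCoeff (h : S.IsLocalDescription U e b₁ b₂ a₃ a₄ a₅) {p : M} (hp : p ∈ U)
    (i j k : Fin 3) : SmoothFnNear (n := 3) (bracketCoeff b₁ b₂ a₃ a₄ a₅ i j k) p := by
  have h1 := h.near_of_contMDiffOn h.smooth_b₁ hp
  have h2 := h.near_of_contMDiffOn h.smooth_b₂ hp
  have h3 := h.near_of_contMDiffOn h.smooth_a₃ hp
  have h4 := h.near_of_contMDiffOn h.smooth_a₄ hp
  have h5 := h.near_of_contMDiffOn h.smooth_a₅ hp
  have hc := fun c : ℝ => smoothFnNear_const (n := 3) c p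
  fin_cases i <;> fin_cases j <;> fin_cases k <;>
    first
    | exact hc 0 | exact h1 | exact h1.neg | exact h3.sub h2 | exact (h3.sub h2).neg
    | exact (hc 2).mul h2 | exact ((hc 2).mul h2).neg | exact h4 | exact h4.neg
    | exact h5 | exact h5.neg

theorem smooth_connCoeff (h : S.IsLocalDescription U e b₁ b₂ a₃ a₄ a₅) {p : M} (hp : p ∈ U)
    (i j k : Fin 3) : SmoothFnNear (n := 3) (connCoeff b₁ b₂ a₃ a₄ a₅ i j k) p := by
  have h1 := h.near_of_contMDiffOn h.smooth_b₁ hp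
  have h2 := h.near_of_contMDiffOn h.smooth_b₂ hp
  have h3 := h.near_of_contMDiffOn h.smooth_a₃ hp
  have h4 := h.near_of_contMDiffOn h.smooth_a₄ hp
  have h5 := h.near_of_contMDiffOn h.smooth_a₅ hp
  have hc := smoothFnNear_const (n := 3) 0 p
  fin_cases i <;> fin_cases j <;> fin_cases k <;>
    first
    | exact hc | exact h1 | exact h1.neg | exact h2 | exact h2.neg | exact h3 | exact h4 | exact h5

theorem bracket_frame (h : S.IsLocalDescription U e b₁ b₂ a₃ a₄ a₅) (p : M) (hp : p ∈ U)
    (i j : Fin 3) : bracket (S.frame e i) (S.frame e j) p =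
      ∑ k, bracketCoeff b₁ b₂ a₃ a₄ a₅ i j k p • S.frame e k p := by
  have h1 := h.xi_e p hp
  have h2 := h.xi_phi p hp
  have h3 := h.e_phi p hp
  have h1' := bracket_swap e S.xi p
  have h2' := bracket_swap (S.phiField e) S.xi p
  have h3' := bracket_swap (S.phiField e) e p
  rw [h1] at h1'
  rw [h2] at h2'
  rw [h3] at h3'
  rw [Fin.sum_univ_three]
  fin_cases i <;> fin_cases j
  · exact (bracket_self _ _).trans (by simp [bracketCoeff])
  · exact h1.trans (by simp [bracketCoeff, frame, phiField])
  · exact h2.trans (by simp [bracketCoeff, frame, phiField]; module)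
  · exact h1'.trans (by simp [bracketCoeff, frame, phiField]; module)
  · exact (bracket_self _ _).trans (by simp [bracketCoeff])
  · exact h3.trans (by simp [bracketCoeff, frame, phiField]; module)
  · exact h2'.trans (by simp [bracketCoeff, frame, phiField]; module)
  · exact h3'.trans (by simp [bracketCoeff, frame, phiField]; module)
  · exact (bracket_self _ _).trans (by simp [bracketCoeff])

theorem nabla_frame (h : S.IsLocalDescription U e b₁ b₂ a₃ a₄ a₅) (p : M) (hp : p ∈ U)
    (i j : Fin 3) : S.g.nabla (S.frame e i) (S.frame e j) p =
      ∑ k, connCoeff b₁ b₂ a₃ a₄ a₅ i j k p • S.frame e k p := by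
  rw [h.isFrame.nabla_frame h.bracket_frame hp]
  refine Finset.sum_congr rfl fun k _ => ?_
  congr 1
  fin_cases i <;> fin_cases j <;> fin_cases k <;>
    simp [bracketCoeff, connCoeff, frameSign] <;> ring

/-- The three equations are the components of the Jacobi identity for ξ, e, φe along ξ, e and φe
respectively. -/
theorem jacobiEquations (h : S.IsLocalDescription U e b₁ b₂ a₃ a₄ a₅) :
    S.JacobiEquations U e b₁ b₂ a₃ a₄ a₅ := by
  intro p hp
  have h2 := (h.near_of_contMDiffOn h.smooth_b₂ hp).at
  have hJ := fun l => h.isFrame.jacobi (fun p hp => h.smooth_bracketCoeff hp) h.bracket_frame hp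
    0 1 2 l
  have J0 := hJ 0
  have J1 := hJ 1
  have J2 := hJ 2
  have hmul : ∀ v, dirDeriv (fun q => 2 * b₂ q) p v = 2 * dirDeriv b₂ p v := fun v => by
    rw [dirDeriv_mul contMDiffAt_const h2, dirDeriv_const]
    ring
  simp only [bracketCoeff, frame, phiField, Fin.sum_univ_three, Matrix.cons_val, dirDeriv_const,
    dirDeriv_neg, hmul] at J0 J1 J2
  refine ⟨?_, ?_, ?_⟩
  · linear_combination J0 / 2
  · linear_combination -J1
  · linear_combination -J2

theorem curvatureAt_frame (h : S.IsLocalDescription U e b₁ b₂ a₃ a₄ a₅) {p : M} (hp : p ∈ U)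
    (i j k : Fin 3) :
    S.g.curvatureAt p (S.frame e i p) (S.frame e j p) (S.frame e k p) =
      ∑ l, (∑ m, bracketCoeff b₁ b₂ a₃ a₄ a₅ i j m p * connCoeff b₁ b₂ a₃ a₄ a₅ m k l p
      - (dirDeriv (connCoeff b₁ b₂ a₃ a₄ a₅ j k l) p (S.frame e i p)
        + ∑ m, connCoeff b₁ b₂ a₃ a₄ a₅ j k m p * connCoeff b₁ b₂ a₃ a₄ a₅ i m l p)
      + (dirDeriv (connCoeff b₁ b₂ a₃ a₄ a₅ i k l) p (S.frame e j p)
        + ∑ m, connCoeff b₁ b₂ a₃ a₄ a₅ i k m p * connCoeff b₁ b₂ a₃ a₄ a₅ j m l p))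
          • S.frame e l p := by
  have hE := h.isFrame
  rw [hE.curvatureAt_eq hp (hE.near hp i) (hE.near hp j) (hE.near hp k)]
  exact hE.curvature_frame (fun p hp => h.smooth_connCoeff hp) (fun p hp => h.smooth_bracketCoeff hp)
    h.nabla_frame h.bracket_frame hp i j k

theorem ricci_frame (h : S.IsLocalDescription U e b₁ b₂ a₃ a₄ a₅) {p : M} (hp : p ∈ U)
    (i k : Fin 3) :
    S.g.ricci p (S.frame e i p) (S.frame e k p) =
      ∑ j, (∑ m, bracketCoeff b₁ b₂ a₃ a₄ a₅ i j m p * connCoeff b₁ b₂ a₃ a₄ a₅ m k j p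
      - (dirDeriv (connCoeff b₁ b₂ a₃ a₄ a₅ j k j) p (S.frame e i p)
        + ∑ m, connCoeff b₁ b₂ a₃ a₄ a₅ j k m p * connCoeff b₁ b₂ a₃ a₄ a₅ i m j p)
      + (dirDeriv (connCoeff b₁ b₂ a₃ a₄ a₅ i k j) p (S.frame e j p)
        + ∑ m, connCoeff b₁ b₂ a₃ a₄ a₅ i k m p * connCoeff b₁ b₂ a₃ a₄ a₅ j m j p)) := by
  rw [h.isFrame.ricci_eq hp]
  refine Finset.sum_congr rfl fun j _ => ?_
  rw [h.curvatureAt_frame hp, h.isFrame.val_sum_smul hp, mul_left_comm, h.isFrame.sign, mul_one]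

theorem ricci_xi_xi (h : S.IsLocalDescription U e b₁ b₂ a₃ a₄ a₅) {p : M} (hp : p ∈ U) :
    S.g.ricci p (S.xi p) (S.xi p) =
      2 * (-dirDeriv b₁ p (S.xi p) - b₁ p ^ 2 - b₂ p ^ 2) := by
  refine (h.ricci_frame hp 0 0).trans ?_
  simp only [bracketCoeff, connCoeff, frame, phiField, Fin.sum_univ_three, Matrix.cons_val,
    dirDeriv_const]
  ring

theorem ricci_e_xi (h : S.IsLocalDescription U e b₁ b₂ a₃ a₄ a₅) {p : M} (hp : p ∈ U) :
    S.g.ricci p (e p) (S.xi p) = dirDeriv b₂ p (S.phi p (e p)) - dirDeriv b₁ p (e p) := by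
  refine (h.ricci_frame hp 1 0).trans ?_
  simp only [bracketCoeff, connCoeff, frame, phiField, Fin.sum_univ_three, Matrix.cons_val,
    dirDeriv_const]
  ring

theorem ricci_phi_xi (h : S.IsLocalDescription U e b₁ b₂ a₃ a₄ a₅) {p : M} (hp : p ∈ U) :
    S.g.ricci p (S.phi p (e p)) (S.xi p) =
      dirDeriv b₂ p (e p) - dirDeriv b₁ p (S.phi p (e p)) := by
  refine (h.ricci_frame hp 2 0).trans ?_
  simp only [bracketCoeff, connCoeff, frame, phiField, Fin.sum_univ_three, Matrix.cons_val,
    dirDeriv_const]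
  ring

theorem ricci_e_e (h : S.IsLocalDescription U e b₁ b₂ a₃ a₄ a₅) {p : M} (hp : p ∈ U) :
    S.g.ricci p (e p) (e p) =
      (-dirDeriv b₁ p (S.xi p) - b₁ p ^ 2 - b₂ p ^ 2)
      + (2 * b₂ p * a₃ p + a₄ p ^ 2 - a₅ p ^ 2 + b₂ p ^ 2 - b₁ p ^ 2
        - dirDeriv a₅ p (e p) + dirDeriv a₄ p (S.phi p (e p))) := by
  refine (h.ricci_frame hp 1 1).trans ?_
  simp only [bracketCoeff, connCoeff, frame, phiField, Fin.sum_univ_three, Matrix.cons_val,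
    dirDeriv_const, dirDeriv_neg]
  ring

end IsLocalDescription

end AlmostParacontactMetric

/-! ### Bookkeeping for derivatives of identities between functions -/

section HasDir

variable {n : ℕ} {M : Type*} [TopologicalSpace M] [ChartedSpace (Model n) M]

/-- The function `f` is smooth at `p` and its derivative along `v` is `d`. -/
structure HasDir (f : M → ℝ) (p : M) (v : TangentSpace (𝓡 n) p) (d : ℝ) : Prop where
  smooth : SmoothFnAt (n := n) f p
  eq : dirDeriv f p v = d

namespace HasDir

variable {f h : M → ℝ} {p : M} {v : TangentSpace (𝓡 n) p} {d d' : ℝ}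

theorem of_near (hf : SmoothFnNear (n := n) f p) (v : TangentSpace (𝓡 n) p) :
    HasDir f p v (dirDeriv f p v) := ⟨hf.at, rfl⟩

theorem const (c : ℝ) (v : TangentSpace (𝓡 n) p) : HasDir (fun _ => c) p v 0 :=
  ⟨contMDiffAt_const, dirDeriv_const c p v⟩

theorem add (hf : HasDir f p v d) (hh : HasDir h p v d') :
    HasDir (fun q => f q + h q) p v (d + d') :=
  ⟨ContMDiffAt.add hf.1 hh.1, by rw [dirDeriv_add hf.1 hh.1, hf.2, hh.2]⟩

theorem sub (hf : HasDir f p v d) (hh : HasDir h p v d') :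
    HasDir (fun q => f q - h q) p v (d - d') :=
  ⟨ContMDiffAt.sub hf.1 hh.1, by rw [dirDeriv_sub hf.1 hh.1, hf.2, hh.2]⟩

theorem mul (hf : HasDir f p v d) (hh : HasDir h p v d') :
    HasDir (fun q => f q * h q) p v (f p * d' + h p * d) :=
  ⟨ContMDiffAt.mul hf.1 hh.1, by rw [dirDeriv_mul hf.1 hh.1, hf.2, hh.2]⟩

theorem eq_of_eqOn {U : Set M} (hU : IsOpen U) (hp : p ∈ U) (hfh : ∀ q ∈ U, f q = h q)
    (hf : HasDir f p v d) (hh : HasDir h p v d') : d = d' := by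
  rw [← hf.2, ← hh.2]
  exact dirDeriv_congr (Filter.eventually_of_mem (hU.mem_nhds hp) hfh) v

end HasDir

end HasDir

/-! ### The soliton equation in a φ-basis -/

namespace AlmostParacontactMetric

variable {M : Type*} [TopologicalSpace M] [ChartedSpace (Model 3) M] [IsManifold (𝓡 3) ∞ M]
  {S : AlmostParacontactMetric M}

namespace IsLocalDescription

variable {U : Set M} {e : VField 3 M} {b₁ b₂ a₃ a₄ a₅ : M → ℝ}

theorem lieDeriv_frame (h : S.IsLocalDescription U e b₁ b₂ a₃ a₄ a₅) {p : M} (hp : p ∈ U)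
    (i j : Fin 3) : S.g.lieDeriv S.xi (S.frame e i) (S.frame e j) p =
      -(bracketCoeff b₁ b₂ a₃ a₄ a₅ 0 i j p * frameSign j
        + bracketCoeff b₁ b₂ a₃ a₄ a₅ 0 j i p * frameSign i) := by
  have hE := h.isFrame
  have hconst : dirDeriv (fun q => S.g.val q (S.frame e i q) (S.frame e j q)) p (S.xi p) = 0 := by
    have : (fun q => S.g.val q (S.frame e i q) (S.frame e j q)) =ᶠ[nhds p]
        fun _ => if i = j then frameSign i else 0 := by
      filter_upwards [h.isOpen.mem_nhds hp] with q hq using hE.val_frame hq i j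
    rw [dirDeriv_congr this, dirDeriv_const]
  have h1 := h.bracket_frame p hp 0 i
  have h2 := h.bracket_frame p hp 0 j
  have h3 := hE.val_sum_smul hp (fun k => bracketCoeff b₁ b₂ a₃ a₄ a₅ 0 i k p) j
  have h4 := hE.val_sum_smul hp (fun k => bracketCoeff b₁ b₂ a₃ a₄ a₅ 0 j k p) i
  rw [← h1] at h3
  rw [← h2, S.g.symm] at h4
  simp only [PseudoMetric.lieDeriv, hconst]
  change 0 - S.g.val p (bracket (S.frame e 0) (S.frame e i) p) (S.frame e j p)
    - S.g.val p (S.frame e i p) (bracket (S.frame e 0) (S.frame e j) p) = _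
  rw [h3, h4]
  ring

theorem ricci_frame_of_soliton (h : S.IsLocalDescription U e b₁ b₂ a₃ a₄ a₅) {c : ℝ}
    (hc : S.g.IsRicciSoliton S.xi c) {p : M} (hp : p ∈ U) (i j : Fin 3) :
    S.g.ricci p (S.frame e i p) (S.frame e j p) =
      c * (if i = j then frameSign i else 0)
      + (bracketCoeff b₁ b₂ a₃ a₄ a₅ 0 i j p * frameSign j
        + bracketCoeff b₁ b₂ a₃ a₄ a₅ 0 j i p * frameSign i) := by
  have hE := h.isFrame
  have h1 := hc p _ _ (hE.near hp i).at (hE.near hp j).at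
  rw [h.lieDeriv_frame hp, hE.val_frame hp] at h1
  linarith

theorem xi_b₁ (h : S.IsLocalDescription U e b₁ b₂ a₃ a₄ a₅) {c : ℝ}
    (hc : S.g.IsRicciSoliton S.xi c) {p : M} (hp : p ∈ U) :
    -dirDeriv b₁ p (S.xi p) - b₁ p ^ 2 - b₂ p ^ 2 = c / 2 := by
  have h1 := h.ricci_xi_xi hp
  have h2 := h.ricci_frame_of_soliton hc hp 0 0
  simp only [frame, frameSign, bracketCoeff, Matrix.cons_val, if_true] at h2
  linarith

theorem e_b₁ (h : S.IsLocalDescription U e b₁ b₂ a₃ a₄ a₅) {c : ℝ}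
    (hc : S.g.IsRicciSoliton S.xi c) {p : M} (hp : p ∈ U) :
    dirDeriv b₁ p (e p) = dirDeriv b₂ p (S.phi p (e p)) := by
  have h1 := h.ricci_e_xi hp
  have h2 := h.ricci_frame_of_soliton hc hp 1 0
  simp only [frame, frameSign, bracketCoeff, Matrix.cons_val, one_ne_zero, if_false] at h2
  linarith

theorem e_b₂ (h : S.IsLocalDescription U e b₁ b₂ a₃ a₄ a₅) {c : ℝ}
    (hc : S.g.IsRicciSoliton S.xi c) {p : M} (hp : p ∈ U) :
    dirDeriv b₂ p (e p) = dirDeriv b₁ p (S.phi p (e p)) := by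
  have h1 := h.ricci_phi_xi hp
  have h2 := h.ricci_frame_of_soliton hc hp 2 0
  have h3 : (2 : Fin 3) ≠ 0 := by decide
  simp only [frame, frameSign, bracketCoeff, Matrix.cons_val, h3, if_false, phiField] at h2
  linarith

/-- The component Ric(e, e) = c − 2b₁ is a sum of two curvature terms; the one from the plane of ξ
and e equals c/2 by `xi_b₁`, and the one from the plane of e and φe is left. -/
theorem horizontal_curvature (h : S.IsLocalDescription U e b₁ b₂ a₃ a₄ a₅) {c : ℝ}
    (hc : S.g.IsRicciSoliton S.xi c) {p : M} (hp : p ∈ U) :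
    2 * (b₂ p * a₃ p) + a₄ p * a₄ p - a₅ p * a₅ p + b₂ p * b₂ p - b₁ p * b₁ p
        - dirDeriv a₅ p (e p) + dirDeriv a₄ p (S.phi p (e p)) = c / 2 - 2 * b₁ p := by
  have h1 := h.ricci_e_e hp
  have h2 := h.ricci_frame_of_soliton hc hp 1 1
  have h3 := h.xi_b₁ hc hp
  simp only [frame, frameSign, bracketCoeff, Matrix.cons_val, if_true] at h2
  linarith

/-- Trace of the soliton equation: tr g = 3 and tr L_ξ g = 4b₁. -/
theorem scalar_eq (h : S.IsLocalDescription U e b₁ b₂ a₃ a₄ a₅) {c : ℝ}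
    (hc : S.g.IsRicciSoliton S.xi c) {p : M} (hp : p ∈ U) :
    S.g.scalar p = 3 * c - 4 * b₁ p := by
  rw [h.isFrame.scalar_eq hp, Fin.sum_univ_three]
  simp only [h.ricci_frame_of_soliton hc hp, if_true]
  simp only [frameSign, bracketCoeff, Matrix.cons_val]
  ring

/-- The `ξ`-component of the contracted second Bianchi identity. -/
theorem xi_b₁_add (h : S.IsLocalDescription U e b₁ b₂ a₃ a₄ a₅) {c : ℝ}
    (hc : S.g.IsRicciSoliton S.xi c) {p : M} (hp : p ∈ U) :
    dirDeriv b₁ p (S.xi p) + 2 * b₁ p ^ 2 = 0 := by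
  have hE := h.isFrame
  have hξ : SmoothFieldNear S.xi p := S.smoothFieldNear_xi p
  have he : SmoothFieldNear e p := hE.near hp 1
  have hf : SmoothFieldNear (S.phiField e) p := hE.near hp 2
  -- The plan is to differentiate `horizontal_curvature` along ξ (`dR4`). Its second-order part is
  -- −ξ(e(a₅)) + ξ(φe(a₄)).
  set A : M → ℝ := fun q => a₃ q - b₂ q with hAdef
  have s1 := h.near_of_contMDiffOn h.smooth_b₁ hp
  have s2 := h.near_of_contMDiffOn h.smooth_b₂ hp
  have s3 := h.near_of_contMDiffOn h.smooth_a₃ hp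
  have s4 := h.near_of_contMDiffOn h.smooth_a₄ hp
  have s5 := h.near_of_contMDiffOn h.smooth_a₅ hp
  have sA : SmoothFnNear (n := 3) A p := s3.sub s2
  obtain ⟨J1, J2, J3⟩ := h.jacobiEquations p hp
  have hA : dirDeriv A p (S.xi p) = dirDeriv a₃ p (S.xi p) - dirDeriv b₂ p (S.xi p) :=
    dirDeriv_sub s3.at s2.at _
  -- `c1` and `c2` move ξ inside, so that ξ(a₅) and ξ(a₄) can be replaced by means of the Jacobi
  -- equations.
  have c1 := dirDeriv_bracket s5 hξ he
  have c2 := dirDeriv_bracket s4 hξ hf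
  have c3 := dirDeriv_bracket sA he hf
  have c4 := dirDeriv_bracket s2 he hf
  rw [h.xi_e p hp] at c1
  rw [h.xi_phi p hp] at c2
  rw [h.e_phi p hp] at c3 c4
  simp only [dirDeriv_vadd, dirDeriv_vsub, dirDeriv_vsmul] at c1 c2 c3 c4
  -- After this replacement the second-order part is −[e, φe]A, handled by `c3`, and −e(e(b₁)) +
  -- φe(φe(b₁)).
  have dJ3 := HasDir.eq_of_eqOn (v := e p) h.isOpen hp
    (f := fun q => dirDeriv a₅ q (S.xi q))
    (h := fun q => dirDeriv b₁ q (e q) + dirDeriv A q (S.phiField e q) - b₁ q * a₅ q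
      + a₄ q * A q)
    (fun q hq => by simp only [hAdef, phiField]; linear_combination (h.jacobiEquations q hq).2.2)
    (.of_near (s5.dirDeriv hξ) _)
    ((((HasDir.of_near (s1.dirDeriv he) _).add (.of_near (sA.dirDeriv hf) _)).sub
      ((HasDir.of_near s1 _).mul (.of_near s5 _))).add ((HasDir.of_near s4 _).mul (.of_near sA _)))
  have dJ2 := HasDir.eq_of_eqOn (v := S.phiField e p) h.isOpen hp
    (f := fun q => dirDeriv a₄ q (S.xi q))
    (h := fun q => dirDeriv A q (e q) + dirDeriv b₁ q (S.phiField e q) - b₁ q * a₄ q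
      + a₅ q * A q)
    (fun q hq => by simp only [hAdef, phiField]; linear_combination -(h.jacobiEquations q hq).2.1)
    (.of_near (s4.dirDeriv hξ) _)
    ((((HasDir.of_near (sA.dirDeriv he) _).add (.of_near (s1.dirDeriv hf) _)).sub
      ((HasDir.of_near s1 _).mul (.of_near s4 _))).add ((HasDir.of_near s5 _).mul (.of_near sA _)))
  -- These turn −e(e(b₁)) + φe(φe(b₁)) into −e(φe(b₂)) + φe(e(b₂)) = −[e, φe]b₂, which is of first
  -- order by `c4`.
  have dR2 := HasDir.eq_of_eqOn (v := e p) h.isOpen hp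
    (f := fun q => dirDeriv b₁ q (e q)) (h := fun q => dirDeriv b₂ q (S.phiField e q))
    (fun q hq => h.e_b₁ hc hq) (.of_near (s1.dirDeriv he) _) (.of_near (s2.dirDeriv hf) _)
  have dR3 := HasDir.eq_of_eqOn (v := S.phiField e p) h.isOpen hp
    (f := fun q => dirDeriv b₂ q (e q)) (h := fun q => dirDeriv b₁ q (S.phiField e q))
    (fun q hq => h.e_b₂ hc hq) (.of_near (s2.dirDeriv he) _) (.of_near (s1.dirDeriv hf) _)
  have dR4 := HasDir.eq_of_eqOn (v := S.xi p) h.isOpen hp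
    (f := fun q => 2 * (b₂ q * a₃ q) + a₄ q * a₄ q - a₅ q * a₅ q + b₂ q * b₂ q - b₁ q * b₁ q
        - dirDeriv a₅ q (e q) + dirDeriv a₄ q (S.phiField e q))
    (h := fun q => c / 2 - 2 * b₁ q)
    (fun q hq => h.horizontal_curvature hc hq)
    (((((((HasDir.const 2 _).mul ((HasDir.of_near s2 _).mul (.of_near s3 _))).add
      ((HasDir.of_near s4 _).mul (.of_near s4 _))).sub
      ((HasDir.of_near s5 _).mul (.of_near s5 _))).add
      ((HasDir.of_near s2 _).mul (.of_near s2 _))).sub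
      ((HasDir.of_near s1 _).mul (.of_near s1 _))).sub (.of_near (s5.dirDeriv he) _) |>.add
      (.of_near (s4.dirDeriv hf) _))
    ((HasDir.const (c / 2) _).sub ((HasDir.const 2 _).mul (.of_near s1 _)))
  have R1 := h.xi_b₁ hc hp
  have R2 := h.e_b₁ hc hp
  have R3 := h.e_b₂ hc hp
  have R4 := h.horizontal_curvature hc hp
  have hAp : A p = a₃ p - b₂ p := rfl
  simp only [← hAdef, phiField, ← hAp] at J2 J3 c1 c2 c3 c4 dJ2 dJ3 dR2 dR3 dR4
  -- The second derivatives cancel in the first group; the undifferentiated Jacobi and soliton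
  -- equations remove the other first-order terms.
  linear_combination (1 / 2) * (dR4 - c1 + c2 + dJ3 - dJ2 - c3 + dR2 + dR3 - c4
    + 2 * a₄ p * J2 + 2 * a₅ p * J3 + a₅ p * R2 + a₄ p * R3 - (2 * a₃ p + 2 * b₂ p) * J1
    + 2 * b₁ p * R4 - 2 * b₁ p * R1 + 2 * b₂ p * hA)

theorem sq_sub_sq (h : S.IsLocalDescription U e b₁ b₂ a₃ a₄ a₅) {c : ℝ}
    (hc : S.g.IsRicciSoliton S.xi c) {p : M} (hp : p ∈ U) :
    b₁ p * b₁ p - b₂ p * b₂ p = c / 2 := by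
  linear_combination h.xi_b₁ hc hp + h.xi_b₁_add hc hp

/-- The ξ-derivative of the constant b₁² − b₂² = c/2 is −4b₁(b₁² − b₂²) = −2c b₁. -/
theorem b₁_mul_eq_zero (h : S.IsLocalDescription U e b₁ b₂ a₃ a₄ a₅) {c : ℝ}
    (hc : S.g.IsRicciSoliton S.xi c) {p : M} (hp : p ∈ U) : b₁ p * c = 0 := by
  have s1 := h.near_of_contMDiffOn h.smooth_b₁ hp
  have s2 := h.near_of_contMDiffOn h.smooth_b₂ hp
  have d := HasDir.eq_of_eqOn (v := S.xi p) h.isOpen hp (h := fun _ => c / 2)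
    (fun q hq => h.sq_sub_sq hc hq)
    (((HasDir.of_near s1 _).mul (.of_near s1 _)).sub ((HasDir.of_near s2 _).mul (.of_near s2 _)))
    (.const _ _)
  have J1 := (h.jacobiEquations p hp).1
  have h1 := h.xi_b₁_add hc hp
  have h2 := h.sq_sub_sq hc hp
  linear_combination (-1 / 2) * d + b₁ p * h1 - b₂ p * J1 - 2 * b₁ p * h2

end IsLocalDescription

end AlmostParacontactMetric

/-! ### Unsteady solitons: Einstein metric and constant curvature -/

theorem PseudoMetric.IsFrame.sum_smul_linear {n : ℕ} {M : Type*} [TopologicalSpace M]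
    [ChartedSpace (Model n) M] [IsManifold (𝓡 n) ∞ M] {g : PseudoMetric n M} {U : Set M}
    {E : Fin n → VField n M} {s : Fin n → ℝ} (hE : g.IsFrame U E s) {p : M} (hp : p ∈ U)
    {A : Type*} [AddCommGroup A] [Module ℝ A] (u : TangentSpace (𝓡 n) p)
    (L : TangentSpace (𝓡 n) p →ₗ[ℝ] A) :
    ∑ i, (s i * g.val p u (E i p)) • L (E i p) = L u := by
  conv_rhs => rw [hE.expand hp u, map_sum]
  exact Finset.sum_congr rfl fun i _ => (map_smul L _ _).symm

namespace AlmostParacontactMetric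

variable {M : Type*} [TopologicalSpace M] [ChartedSpace (Model 3) M] [IsManifold (𝓡 3) ∞ M]
  {S : AlmostParacontactMetric M}

namespace IsLocalDescription

variable {U : Set M} {e : VField 3 M} {b₁ b₂ a₃ a₄ a₅ : M → ℝ}

theorem b₁_eq_zero (h : S.IsLocalDescription U e b₁ b₂ a₃ a₄ a₅) {c : ℝ} (hc0 : c ≠ 0)
    (hc : S.g.IsRicciSoliton S.xi c) {p : M} (hp : p ∈ U) : b₁ p = 0 :=
  (mul_eq_zero.1 (h.b₁_mul_eq_zero hc hp)).resolve_right hc0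

theorem b₂_sq (h : S.IsLocalDescription U e b₁ b₂ a₃ a₄ a₅) {c : ℝ} (hc0 : c ≠ 0)
    (hc : S.g.IsRicciSoliton S.xi c) {p : M} (hp : p ∈ U) : b₂ p ^ 2 = -(c / 2) := by
  have h1 := h.sq_sub_sq hc hp
  rw [h.b₁_eq_zero hc0 hc hp] at h1
  linear_combination -h1

theorem ricci_eq_of_ne_zero (h : S.IsLocalDescription U e b₁ b₂ a₃ a₄ a₅) {c : ℝ} (hc0 : c ≠ 0)
    (hc : S.g.IsRicciSoliton S.xi c) {p : M} (hp : p ∈ U) (u v : TangentSpace (𝓡 3) p) :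
    S.g.ricci p u v = c * S.g.val p u v := by
  have hE := h.isFrame
  have hb := h.b₁_eq_zero hc0 hc hp
  have key : ∀ i j, S.g.ricci p (S.frame e i p) (S.frame e j p) =
      c * (if i = j then frameSign i else 0) := by
    intro i j
    rw [h.ricci_frame_of_soliton hc hp]
    fin_cases i <;> fin_cases j <;> simp [frameSign, bracketCoeff, hb]
  rw [hE.ricci_left hp]
  simp only [hE.ricci_right hp _ v, key]
  conv_rhs => rw [hE.expand hp u]
  rw [PseudoMetric.val_sum_left, Finset.mul_sum]
  refine Finset.sum_congr rfl fun i _ => ?_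
  simp only [mul_ite, mul_zero, Finset.sum_ite_eq, Finset.mem_univ, if_true, map_smul, smul_apply,
    smul_eq_mul]
  rw [S.g.symm p (S.frame e i p) v]
  linear_combination (c * frameSign i * S.g.val p u (S.frame e i p) * S.g.val p v (S.frame e i p)) *
    hE.sign i

/-- An Einstein metric in dimension three has constant curvature. Here this is verified on the
frame: b₁ vanishes, b₂ is locally constant, and the Jacobi equations with `horizontal_curvature`
eliminate the remaining derivatives. -/
theorem curvatureAt_eq_of_ne_zero (h : S.IsLocalDescription U e b₁ b₂ a₃ a₄ a₅) {c : ℝ}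
    (hc0 : c ≠ 0) (hc : S.g.IsRicciSoliton S.xi c) {p : M} (hp : p ∈ U)
    (u v w : TangentSpace (𝓡 3) p) :
    S.g.curvatureAt p u v w =
      (c / 2) • (S.g.val p u w • v - S.g.val p v w • u) := by
  have hE := h.isFrame
  have hb := h.b₁_eq_zero hc0 hc hp
  have hb2 := h.b₂_sq hc0 hc hp
  have hb2' : b₂ p ≠ 0 := by
    intro h0
    rw [h0] at hb2
    exact hc0 (by linarith)
  have hd1 : ∀ x : TangentSpace (𝓡 3) p, dirDeriv b₁ p x = 0 := by
    intro x
    have : b₁ =ᶠ[nhds p] fun _ => 0 :=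
      Filter.eventually_of_mem (h.isOpen.mem_nhds hp) fun q hq => h.b₁_eq_zero hc0 hc hq
    rw [dirDeriv_congr this, dirDeriv_const]
  have s2 := h.near_of_contMDiffOn h.smooth_b₂ hp
  have s3 := h.near_of_contMDiffOn h.smooth_a₃ hp
  -- The square of b₂ is a nonzero constant, so b₂ db₂ = 0 forces db₂ = 0.
  have hd2 : ∀ x : TangentSpace (𝓡 3) p, dirDeriv b₂ p x = 0 := by
    intro x
    have d := HasDir.eq_of_eqOn (v := x) h.isOpen hp (h := fun _ => -(c / 2))
      (fun q hq => (pow_two (b₂ q)).symm.trans (h.b₂_sq hc0 hc hq))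
      ((HasDir.of_near s2 _).mul (.of_near s2 _)) (.const _ _)
    have : b₂ p * dirDeriv b₂ p x = 0 := by linarith
    exact (mul_eq_zero.1 this).resolve_left hb2'
  obtain ⟨J1, J2, J3⟩ := h.jacobiEquations p hp
  have hA : ∀ x : TangentSpace (𝓡 3) p, dirDeriv (fun q => a₃ q - b₂ q) p x = dirDeriv a₃ p x := fun x => by
    rw [dirDeriv_sub s3.at s2.at, hd2, sub_zero]
  simp only [hA, hd1, hb] at J2 J3
  have R4 := h.horizontal_curvature hc hp
  rw [hb] at R4
  have key : ∀ i j k, S.g.curvatureAt p (S.frame e i p) (S.frame e j p) (S.frame e k p) =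
      (c / 2) • ((if i = k then frameSign i else 0) • S.frame e j p
        - (if j = k then frameSign j else 0) • S.frame e i p) := by
    intro i j k
    rw [h.curvatureAt_frame hp, Fin.sum_univ_three]
    simp only [Fin.sum_univ_three]
    have hcb : c = -2 * b₂ p ^ 2 := by linarith
    have J2' : dirDeriv a₄ p (S.xi p) = dirDeriv a₃ p (e p) + a₅ p * (a₃ p - b₂ p) := by linarith
    have J3' : dirDeriv a₅ p (S.xi p) =
        dirDeriv a₃ p (S.phi p (e p)) + a₄ p * (a₃ p - b₂ p) := by linarith
    have R4' : dirDeriv a₄ p (S.phi p (e p)) = c / 2 - (2 * (b₂ p * a₃ p) + a₄ p * a₄ p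
      - a₅ p * a₅ p + b₂ p * b₂ p - dirDeriv a₅ p (e p)) := by linarith
    fin_cases i <;> fin_cases j <;> fin_cases k <;>
      simp [bracketCoeff, connCoeff, frameSign, frame, phiField, dirDeriv_neg, hd1, hd2, hb,
        J2', J3', R4', hcb] <;>
      module
  simp only [← hE.val_frame hp] at key
  -- Both sides are trilinear, so agreement on the frame is extended one slot at a time.
  let L : TangentSpace (𝓡 3) p → TangentSpace (𝓡 3) p → TangentSpace (𝓡 3) p →
      TangentSpace (𝓡 3) p := fun u v w => (c / 2) • (S.g.val p u w • v - S.g.val p v w • u)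
  have key1 : ∀ i j w, S.g.curvatureAt p (S.frame e i p) (S.frame e j p) w =
      L (S.frame e i p) (S.frame e j p) w := fun i j w => by
    rw [hE.curvatureAt_right hp]
    simp only [key]
    exact hE.sum_smul_linear hp w
      { toFun := L (S.frame e i p) (S.frame e j p)
        map_add' := fun x y => by simp only [L, map_add]; module
        map_smul' := fun a x => by simp only [L, map_smul, smul_eq_mul, RingHom.id_apply]; module }
  have key2 : ∀ i v w, S.g.curvatureAt p (S.frame e i p) v w =
      L (S.frame e i p) v w := fun i v w => by
    rw [hE.curvatureAt_mid hp]
    simp only [key1]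
    exact hE.sum_smul_linear hp v
      { toFun := fun v => L (S.frame e i p) v w
        map_add' := fun x y => by simp only [L, map_add, add_apply]; module
        map_smul' := fun a x => by
          simp only [L, map_smul, smul_apply, smul_eq_mul, RingHom.id_apply]; module }
  rw [hE.curvatureAt_left hp]
  simp only [key2]
  exact hE.sum_smul_linear hp u
    { toFun := fun u => L u v w
      map_add' := fun x y => by simp only [L, map_add, add_apply]; module
      map_smul' := fun a x => by
        simp only [L, map_smul, smul_apply, smul_eq_mul, RingHom.id_apply]; module }

end IsLocalDescription

end AlmostParacontactMetric

/-! ### Propagation of zeros along transversal integral curves -/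

section IntegralCurves

open Filter Topology

variable {E : Type*} [NormedAddCommGroup E] [NormedSpace ℝ E] [CompleteSpace E]

/-- The integral curves of a `C¹` vector field that start near `z₀` exist for a common time, during
which they stay in a given neighbourhood of `z₀`. -/
theorem exists_integralCurve_mem {f : E → E} {z₀ : E} (hf : ContDiffAt ℝ 1 f z₀) {N : Set E}
    (hN : N ∈ 𝓝 z₀) : ∃ ε > (0 : ℝ), ∀ᶠ z in 𝓝 z₀, ∃ γ : ℝ → E, γ 0 = z ∧
      ∀ t ∈ Set.Icc 0 ε, HasDerivAt γ (f (γ t)) t ∧ γ t ∈ N := by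
  obtain ⟨δ, hδ, a, r, L, K, hr, hpl⟩ := IsPicardLindelof.of_contDiffAt_one hf
  obtain ⟨α, hα, hcont⟩ :=
    (hpl 0).exists_forall_mem_closedBall_eq_hasDerivWithinAt_continuousOn
  have hball : Metric.closedBall z₀ (r : ℝ) ∈ 𝓝 z₀ := Metric.closedBall_mem_nhds z₀ hr
  have h0 := hα z₀ (mem_of_mem_nhds hball)
  have hat : ContinuousAt α (z₀, 0) :=
    hcont.continuousAt (prod_mem_nhds hball (Icc_mem_nhds (by linarith) (by linarith)))
  have hmem : ∀ᶠ y in 𝓝 z₀ ×ˢ 𝓝 (0 : ℝ), α y ∈ N := by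
    rw [← nhds_prod_eq]
    exact hat.eventually_mem (by rwa [h0.1])
  obtain ⟨P, hP, Q, hQ, hPQ⟩ := eventually_prod_iff.1 hmem
  obtain ⟨ρ, hρ, hρQ⟩ := Metric.eventually_nhds_iff.1 hQ
  -- Halving δ keeps the closed time interval in the interior of the interval of existence, so
  -- one-sided derivatives become genuine ones at the endpoints too.
  refine ⟨min (δ / 2) (ρ / 2), by positivity, ?_⟩
  filter_upwards [hball, hP] with z hz hzP
  refine ⟨fun t => α (z, t), (hα z hz).1, fun t ht => ?_⟩
  have h1 : t ≤ δ / 2 := ht.2.trans (min_le_left _ _)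
  have h2 : t ≤ ρ / 2 := ht.2.trans (min_le_right _ _)
  have h3 : 0 ≤ t := ht.1
  refine ⟨((hα z hz).2 t ⟨by linarith, by linarith⟩).hasDerivAt
    (Icc_mem_nhds (by linarith) (by linarith)), hPQ hzP (hρQ ?_)⟩
  rw [Real.dist_eq, sub_zero, abs_of_nonneg h3]
  linarith

/-- A function whose derivative is bounded by a multiple of it vanishes either everywhere or
nowhere. -/
theorem ne_zero_of_abs_deriv_le {f f' : ℝ → ℝ} {K T : ℝ} (hT : 0 ≤ T)
    (hf : ∀ t ∈ Set.Icc 0 T, HasDerivAt f (f' t) t)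
    (hK : ∀ t ∈ Set.Icc 0 T, |f' t| ≤ K * |f t|) (h0 : f 0 ≠ 0) : f T ≠ 0 := by
  intro hTf
  have hrev : ∀ t ∈ Set.Icc 0 T, T - t ∈ Set.Icc 0 T := fun t ht =>
    ⟨by linarith [ht.2], by linarith [ht.1]⟩
  have hd : ∀ t ∈ Set.Icc 0 T, HasDerivAt (fun t => f (T - t)) (-f' (T - t)) t := fun t ht => by
    have := (hf _ (hrev t ht)).comp t ((hasDerivAt_id t).const_sub T)
    simpa [Function.comp_def] using this
  -- Grönwall's inequality run backwards in time: a zero at T would force a zero at 0.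
  have := eq_zero_of_abs_deriv_le_mul_abs_self_of_eq_zero_right (K := K)
    (fun t ht => (hd t ht).continuousAt.continuousWithinAt)
    (fun t ht => (hd t (Set.Ico_subset_Icc_self ht)).hasDerivWithinAt)
    (by simpa using hTf)
    (fun t ht => by
      simpa using hK _ (hrev t (Set.Ico_subset_Icc_self ht))) T ⟨hT, le_rfl⟩
  exact h0 (by simpa using this)

/-- Let `P` and `Q` be families of operators whose ranges span, let `u` and `v` satisfy linear
differential equations along the range of `P` and of `Q`. If `u v = 0`, then locally `u = 0` or
`v = 0`: curves along the range of `P` and of `Q` join any two nearby points. -/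
theorem eventually_eq_zero_or_of_mul_eq_zero {P Q : E → E →L[ℝ] E} {x₀ : E}
    (hP : ContDiffAt ℝ 1 P x₀) (hQ : ContDiffAt ℝ 1 Q x₀) (hPQ : P x₀ + Q x₀ = 1)
    {u v : E → ℝ} (hu : ∀ᶠ x in 𝓝 x₀, DifferentiableAt ℝ u x)
    (hv : ∀ᶠ x in 𝓝 x₀, DifferentiableAt ℝ v x) {K : ℝ}
    (huP : ∀ᶠ x in 𝓝 x₀, ∀ w, |fderiv ℝ u x (P x w)| ≤ K * ‖w‖ * |u x|)
    (hvQ : ∀ᶠ x in 𝓝 x₀, ∀ w, |fderiv ℝ v x (Q x w)| ≤ K * ‖w‖ * |v x|)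
    (huv : ∀ᶠ x in 𝓝 x₀, u x * v x = 0) :
    (∀ᶠ x in 𝓝 x₀, u x = 0) ∨ ∀ᶠ x in 𝓝 x₀, v x = 0 := by
  have hK : ∀ w : E, K * ‖w‖ ≤ |K| * ‖w‖ := fun w =>
    mul_le_mul_of_nonneg_right (le_abs_self K) (norm_nonneg w)
  -- For the system x' = P(x)Rw, y' = −Q(y)Rw, w' = 0 with R = (P(x) + Q(y))⁻¹, the difference
  -- satisfies (x − y)' = w. So x moves along the range of P, y along that of Q, and their
  -- separation evolves linearly.
  let R : E × E × E → E →L[ℝ] E := fun z => Ring.inverse (P z.1 + Q z.2.1)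
  let z₀ : E × E × E := (x₀, x₀, 0)
  have hPz : ContDiffAt ℝ 1 (fun z : E × E × E => P z.1) z₀ :=
    ContDiffAt.comp z₀ (g := P) (f := fun z : E × E × E => z.1) hP contDiffAt_fst
  have hQz : ContDiffAt ℝ 1 (fun z : E × E × E => Q z.2.1) z₀ :=
    ContDiffAt.comp z₀ (g := Q) (f := fun z : E × E × E => z.2.1) hQ
      (contDiffAt_fst.comp z₀ contDiffAt_snd)
  have hz₀ : P z₀.1 + Q z₀.2.1 = ((1 : (E →L[ℝ] E)ˣ) : E →L[ℝ] E) := hPQ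
  have hR : ContDiffAt ℝ 1 R z₀ := by
    refine ContDiffAt.comp z₀ (g := Ring.inverse) ?_ (hPz.add hQz)
    rw [hz₀]
    exact contDiffAt_ringInverse ℝ 1
  have hRw : ContDiffAt ℝ 1 (fun z : E × E × E => R z z.2.2) z₀ :=
    hR.clm_apply (contDiffAt_snd.comp z₀ contDiffAt_snd)
  let f : E × E × E → E × E × E := fun z => (P z.1 (R z z.2.2), -Q z.2.1 (R z z.2.2), 0)
  have hf : ContDiffAt ℝ 1 f z₀ :=
    (hPz.clm_apply hRw).prodMk ((hQz.clm_apply hRw).neg.prodMk contDiffAt_const)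
  have hunit : ∀ᶠ z in 𝓝 z₀, IsUnit (P z.1 + Q z.2.1) := by
    have := (hPz.add hQz).continuousAt.eventually_mem (s := {x | IsUnit x}) (by
      rw [hz₀]
      exact Units.nhds 1)
    exact this
  have hbound : ∀ᶠ z in 𝓝 z₀, ‖R z z.2.2‖ < 1 :=
    hRw.continuousAt.norm.eventually_lt continuousAt_const (by simp [z₀])
  have hfst : Tendsto (fun z : E × E × E => z.1) (𝓝 z₀) (𝓝 x₀) := continuous_fst.tendsto z₀
  have hsnd : Tendsto (fun z : E × E × E => z.2.1) (𝓝 z₀) (𝓝 x₀) :=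
    (continuous_fst.comp continuous_snd).tendsto z₀
  obtain ⟨ε, hε, hflow⟩ := exists_integralCurve_mem hf
    (hunit.and <| hbound.and <| (hfst.eventually (hu.and (huP.and huv))).and
      (hsnd.eventually (hv.and hvQ)))
  -- With w = (q₂ − q₁)/ε the curves from q₁ and q₂ meet at time ε. As ε is fixed before q₁ and q₂,
  -- this w is small when both points are near x₀, so the starting point lies in the domain of the
  -- common-time flow.
  have hstart : Tendsto (fun q : E × E => ((q.1, q.2, ε⁻¹ • (q.2 - q.1)) : E × E × E))
      (𝓝 x₀ ×ˢ 𝓝 x₀) (𝓝 z₀) := by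
    rw [← nhds_prod_eq]
    have : Continuous fun q : E × E => ((q.1, q.2, ε⁻¹ • (q.2 - q.1)) : E × E × E) := by fun_prop
    simpa [z₀] using this.tendsto (x₀, x₀)
  by_contra hcon
  push Not at hcon
  obtain ⟨hu0, hv0⟩ := hcon
  obtain ⟨A, hA, B, hB, hAB⟩ := eventually_prod_iff.1 (hstart.eventually hflow)
  obtain ⟨q₁, hq₁, hA₁⟩ := (hu0.and_eventually hA).exists
  obtain ⟨q₂, hq₂, hB₂⟩ := (hv0.and_eventually hB).exists
  obtain ⟨γ, hγ0, hγ⟩ := hAB hA₁ hB₂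
  have hx : ∀ t ∈ Set.Icc 0 ε, HasDerivAt (fun t => (γ t).1)
      (P (γ t).1 (R (γ t) (γ t).2.2)) t := fun t ht => (hγ t ht).1.fst
  have hy : ∀ t ∈ Set.Icc 0 ε, HasDerivAt (fun t => (γ t).2.1)
      (-Q (γ t).2.1 (R (γ t) (γ t).2.2)) t := fun t ht => (hγ t ht).1.snd.fst
  have hw : ∀ t ∈ Set.Icc 0 ε, HasDerivAt (fun t => (γ t).2.2) 0 t :=
    fun t ht => (hγ t ht).1.snd.snd
  have hw0 : ∀ t ∈ Set.Icc 0 ε, (γ t).2.2 = ε⁻¹ • (q₂ - q₁) := fun t ht => by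
    rw [constant_of_has_deriv_right_zero (fun t ht => (hw t ht).continuousAt.continuousWithinAt)
      (fun t ht => (hw t (Set.Ico_subset_Icc_self ht)).hasDerivWithinAt) t ht, hγ0]
  have hε0 : ε ∈ Set.Icc 0 ε := ⟨hε.le, le_rfl⟩
  have hdiff : ∀ t ∈ Set.Icc 0 ε, HasDerivAt
      (fun t => (γ t).1 - (γ t).2.1 - t • (ε⁻¹ • (q₂ - q₁))) 0 t := fun t ht => by
    have h1 := Ring.mul_inverse_cancel _ (hγ t ht).2.1
    have h2 : P (γ t).1 (R (γ t) (γ t).2.2) + Q (γ t).2.1 (R (γ t) (γ t).2.2) = (γ t).2.2 :=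
      DFunLike.congr_fun h1 (γ t).2.2
    have h3 := ((hx t ht).sub (hy t ht)).sub
      ((hasDerivAt_id t).smul_const (ε⁻¹ • (q₂ - q₁)))
    rwa [sub_neg_eq_add, h2, hw0 t ht, one_smul, sub_self] at h3
  have hmeet : (γ ε).1 = (γ ε).2.1 := by
    have := constant_of_has_deriv_right_zero
      (fun t ht => (hdiff t ht).continuousAt.continuousWithinAt)
      (fun t ht => (hdiff t (Set.Ico_subset_Icc_self ht)).hasDerivWithinAt) ε hε0
    simp only [hγ0, smul_smul, mul_inv_cancel₀ hε.ne', one_smul, zero_mul, zero_smul] at this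
    rw [← sub_eq_zero]
    calc (γ ε).1 - (γ ε).2.1 = (γ ε).1 - (γ ε).2.1 - (q₂ - q₁) + (q₂ - q₁) := by abel
      _ = 0 := by rw [this]; abel
  -- Along the curve ‖Rw‖ < 1, so the differential inequality holds with the single constant |K|.
  have hu1 : u (γ ε).1 ≠ 0 := by
    refine ne_zero_of_abs_deriv_le (f := fun t => u (γ t).1) (K := |K|) hε.le
      (fun t ht => (hγ t ht).2.2.2.1.1.hasFDerivAt.comp_hasDerivAt t (hx t ht)) (fun t ht => ?_)
      (by simpa [hγ0] using hq₁)
    refine ((hγ t ht).2.2.2.1.2.1 _).trans (mul_le_mul_of_nonneg_right ((hK _).trans ?_)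
      (abs_nonneg _))
    exact mul_le_of_le_one_right (abs_nonneg K) (hγ t ht).2.2.1.le
  have hv1 : v (γ ε).2.1 ≠ 0 := by
    refine ne_zero_of_abs_deriv_le (f := fun t => v (γ t).2.1) (K := |K|) hε.le
      (fun t ht => (hγ t ht).2.2.2.2.1.hasFDerivAt.comp_hasDerivAt t (hy t ht)) (fun t ht => ?_)
      (by simpa [hγ0] using hq₂)
    rw [map_neg, abs_neg]
    refine ((hγ t ht).2.2.2.2.2 _).trans (mul_le_mul_of_nonneg_right ((hK _).trans ?_)
      (abs_nonneg _))
    exact mul_le_of_le_one_right (abs_nonneg K) (hγ t ht).2.2.1.le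
  have huv1 := (hγ ε hε0).2.2.2.1.2.2
  rw [← hmeet] at hv1
  exact mul_ne_zero hu1 hv1 huv1

end IntegralCurves

/-! ### Transfer of the propagation argument to the manifold through a chart -/

section Coordinates

open Filter Topology

variable {n : ℕ} {M : Type*} [TopologicalSpace M] [ChartedSpace (Model n) M]

theorem contDiffAt_comp_extChartAt_symm {F : Type*} [NormedAddCommGroup F] [NormedSpace ℝ F]
    {f : M → F} {p : M} (hf : ContMDiffAt (𝓡 n) 𝓘(ℝ, F) ∞ f p) :
    ContDiffAt ℝ ∞ (fun x => f ((extChartAt (𝓡 n) p).symm x)) (extChartAt (𝓡 n) p p) := by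
  have := (contMDiffAt_iff.1 hf).2
  rw [ModelWithCorners.range_eq_univ, contDiffWithinAt_univ] at this
  exact this

variable [IsManifold (𝓡 n) ∞ M]

/-- The components of the vector field `X` in the chart at `p`. -/
noncomputable def chartField (X : VField n M) (p : M) : Model n → Model n := fun x =>
  mfderiv (𝓡 n) 𝓘(ℝ, Model n) (extChartAt (𝓡 n) p) ((extChartAt (𝓡 n) p).symm x)
    (X ((extChartAt (𝓡 n) p).symm x))

/-- The differential of the chart at p is the local trivialization of the tangent bundle, in which
smoothness of a section is tested. -/
theorem SmoothFieldAt.contDiffAt_chartField {X : VField n M} {p : M} (hX : SmoothFieldAt X p) :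
    ContDiffAt ℝ ∞ (chartField X p) (extChartAt (𝓡 n) p p) := by
  have : IsManifold (𝓡 n) 1 M := IsManifold.of_le (n := ∞) (by simp)
  have h1 := contDiffAt_comp_extChartAt_symm ((contMDiffAt_section p).1 hX)
  refine h1.congr_of_eventuallyEq ?_
  filter_upwards [extChartAt_target_mem_nhds (I := 𝓡 n) p] with x hx
  have hq : (extChartAt (𝓡 n) p).symm x ∈ (chartAt (Model n) p).source := by
    rw [← extChartAt_source (𝓡 n)]
    exact (extChartAt (𝓡 n) p).map_target hx
  refine (congrArg (fun L : Model n →L[ℝ] Model n => L (X ((extChartAt (𝓡 n) p).symm x)))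
    (TangentBundle.continuousLinearMapAt_trivializationAt (I := 𝓡 n) hq)).symm.trans ?_
  have hb : (extChartAt (𝓡 n) p).symm x ∈
      (trivializationAt (Model n) (TangentSpace (𝓡 n)) p).baseSet := by
    simpa using hq
  exact congrFun (Trivialization.coe_linearMapAt_of_mem (R := ℝ)
    (trivializationAt (Model n) (TangentSpace (𝓡 n)) p) hb) _

theorem dirDeriv_eq_fderiv_chart {u : M → ℝ} {p q : M} (hq : q ∈ (chartAt (Model n) p).source)
    (hu : SmoothFnAt (n := n) u q) (v : TangentSpace (𝓡 n) q) :
    DifferentiableAt ℝ (fun x => u ((extChartAt (𝓡 n) p).symm x)) (extChartAt (𝓡 n) p q) ∧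
    dirDeriv u q v =
      fderiv ℝ (fun x => u ((extChartAt (𝓡 n) p).symm x)) (extChartAt (𝓡 n) p q)
        (mfderiv (𝓡 n) 𝓘(ℝ, Model n) (extChartAt (𝓡 n) p) q v) := by
  have : IsManifold (𝓡 n) 1 M := IsManifold.of_le (n := ∞) (by simp)
  have hq' : q ∈ (extChartAt (𝓡 n) p).source := by rwa [extChartAt_source]
  have hφ : MDifferentiableAt (𝓡 n) 𝓘(ℝ, Model n) (extChartAt (𝓡 n) p) q :=
    mdifferentiableAt_extChartAt hq
  have hs : MDifferentiableAt 𝓘(ℝ, Model n) (𝓡 n) (extChartAt (𝓡 n) p).symm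
      (extChartAt (𝓡 n) p q) := by
    have := mdifferentiableWithinAt_extChartAt_symm (I := 𝓡 n)
      ((extChartAt (𝓡 n) p).map_source hq')
    rwa [ModelWithCorners.range_eq_univ, mdifferentiableWithinAt_univ] at this
  have hinv : (extChartAt (𝓡 n) p).symm (extChartAt (𝓡 n) p q) = q :=
    (extChartAt (𝓡 n) p).left_inv hq'
  have hd : MDifferentiableAt 𝓘(ℝ, Model n) 𝓘(ℝ, ℝ)
      (fun x => u ((extChartAt (𝓡 n) p).symm x)) (extChartAt (𝓡 n) p q) := by
    refine MDifferentiableAt.comp (g := u) (I' := 𝓡 n) _ ?_ hs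
    rw [hinv]
    exact hu.mdiff
  refine ⟨hd.differentiableAt, ?_⟩
  have hc : u =ᶠ[𝓝 q] (fun x => u ((extChartAt (𝓡 n) p).symm x)) ∘ extChartAt (𝓡 n) p := by
    filter_upwards [extChartAt_source_mem_nhds' (I := 𝓡 n) hq'] with y hy
    simp only [Function.comp_apply, (extChartAt (𝓡 n) p).left_inv hy]
  rw [dirDeriv_congr hc, ← mfderiv_eq_fderiv]
  have h2 := mfderiv_comp q hd hφ
  exact congrArg (fun L : Model n →L[ℝ] ℝ => L v) h2

/-- Let `X`, `Y`, `Z` span the tangent space at `p`. If `u` is constant along `X`, while `v` is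
constant along `Y` and satisfies a linear differential equation along `Z`, and if `u v = 0`, then
`u = 0` near `p` or `v = 0` near `p`. -/
theorem eventually_eq_zero_or_of_dirDeriv {X Y Z : VField n M} {p : M} (hX : SmoothFieldAt X p)
    (hY : SmoothFieldAt Y p) (hZ : SmoothFieldAt Z p) {α β ζ : TangentSpace (𝓡 n) p →L[ℝ] ℝ}
    (hspan : ∀ w, α w • X p + (β w • Y p + ζ w • Z p) = w) {u v κ : M → ℝ}
    (hu : SmoothFnNear (n := n) u p) (hv : SmoothFnNear (n := n) v p)
    (huX : ∀ᶠ q in 𝓝 p, dirDeriv u q (X q) = 0) (hvY : ∀ᶠ q in 𝓝 p, dirDeriv v q (Y q) = 0)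
    (hvZ : ∀ᶠ q in 𝓝 p, dirDeriv v q (Z q) = κ q * v q) (hκ : ContinuousAt κ p)
    (huv : ∀ᶠ q in 𝓝 p, u q * v q = 0) :
    (∀ᶠ q in 𝓝 p, u q = 0) ∨ ∀ᶠ q in 𝓝 p, v q = 0 := by
  set φ := extChartAt (𝓡 n) p with hφ
  have hinv : φ.symm (φ p) = p := extChartAt_to_inv p
  have htend : Tendsto φ.symm (𝓝 (φ p)) (𝓝 p) := by
    have := continuousAt_extChartAt_symm (I := 𝓡 n) p
    rwa [ContinuousAt, ← hφ, hinv] at this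
  have hback : ∀ f : M → ℝ, (∀ᶠ x in 𝓝 (φ p), f (φ.symm x) = 0) → ∀ᶠ q in 𝓝 p, f q = 0 := by
    intro f hf
    filter_upwards [(continuousAt_extChartAt (I := 𝓡 n) p).eventually hf,
      extChartAt_source_mem_nhds (I := 𝓡 n) p] with q hq hs
    rwa [← hφ, φ.left_inv hs] at hq
  have htgt := extChartAt_target_mem_nhds (I := 𝓡 n) p
  have hsrc : ∀ x ∈ φ.target, φ.symm x ∈ (chartAt (Model n) p).source := fun x hx => by
    rw [← extChartAt_source (𝓡 n)]
    exact φ.map_target hx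
  have hder : ∀ f : M → ℝ, SmoothFnNear (n := n) f p → ∀ᶠ x in 𝓝 (φ p),
      DifferentiableAt ℝ (fun x => f (φ.symm x)) x ∧ ∀ W : VField n M,
        fderiv ℝ (fun x => f (φ.symm x)) x (chartField W p x) =
          dirDeriv f (φ.symm x) (W (φ.symm x)) := by
    intro f hf
    filter_upwards [htgt, htend.eventually hf] with x hx hfx
    have h1 := fun w => dirDeriv_eq_fderiv_chart (hsrc x hx) hfx w
    simp only [← hφ, φ.right_inv hx] at h1
    exact ⟨(h1 0).1, fun W => (h1 _).2.symm⟩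
  obtain ⟨L', hL⟩ := isInvertible_mfderiv_extChartAt (I := 𝓡 n) (mem_extChartAt_source p)
  let L : TangentSpace (𝓡 n) p ≃L[ℝ] Model n := L'
  have hfield : ∀ W : VField n M, chartField W p (φ p) = L (W p) := by
    intro W
    have h1 : ∀ q, q = p → (mfderiv (𝓡 n) 𝓘(ℝ, Model n) φ q (W q) : Model n) = L (W p) := by
      rintro q rfl
      exact congrArg (fun T : Model n →L[ℝ] Model n => T (W q)) hL.symm
    exact h1 _ hinv
  let A : Model n →L[ℝ] ℝ := α.comp L.symm.toContinuousLinearMap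
  let B : Model n →L[ℝ] ℝ := β.comp L.symm.toContinuousLinearMap
  let C : Model n →L[ℝ] ℝ := ζ.comp L.symm.toContinuousLinearMap
  have hone : (1 : WithTop ℕ∞) ≤ ∞ := by simp
  -- The coefficient functionals are frozen at p and only the fields vary: the ranges stay in the
  -- span of X, respectively of Y and Z, and P + Q is the identity at p.
  let P : Model n → Model n →L[ℝ] Model n := fun x => A.smulRight (chartField X p x)
  let Q : Model n → Model n →L[ℝ] Model n := fun x =>
    B.smulRight (chartField Y p x) + C.smulRight (chartField Z p x)
  have hP : ContDiffAt ℝ 1 P (φ p) :=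
    contDiffAt_const.smulRight (hX.contDiffAt_chartField.of_le hone)
  have hQ : ContDiffAt ℝ 1 Q (φ p) :=
    (contDiffAt_const.smulRight (hY.contDiffAt_chartField.of_le hone)).add
      (contDiffAt_const.smulRight (hZ.contDiffAt_chartField.of_le hone))
  have hPQ : P (φ p) + Q (φ p) = 1 := by
    ext1 w
    have := congrArg L (hspan (L.symm w))
    rw [map_add, map_add, map_smul, map_smul, map_smul, L.apply_symm_apply] at this
    simp only [P, Q, hfield]
    exact this
  have hκ' : ∀ᶠ x in 𝓝 (φ p), |κ (φ.symm x)| < |κ p| + 1 :=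
    htend.eventually (hκ.abs.eventually_lt continuousAt_const (by linarith))
  have hK : 0 ≤ (|κ p| + 1) * ‖C‖ := by positivity
  refine (eventually_eq_zero_or_of_mul_eq_zero hP hQ hPQ
    (u := fun x => u (φ.symm x)) (v := fun x => v (φ.symm x)) (K := (|κ p| + 1) * ‖C‖)
    ((hder u hu).mono fun x hx => hx.1) ((hder v hv).mono fun x hx => hx.1) ?_ ?_
    (htend.eventually huv)).imp (hback u) (hback v)
  · filter_upwards [hder u hu, htend.eventually huX] with x hx h1 w
    simp only [P, ContinuousLinearMap.smulRight_apply, map_smul, hx.2, h1, smul_zero, abs_zero]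
    positivity
  · filter_upwards [hder v hv, htend.eventually hvY, htend.eventually hvZ, hκ'] with x hx h1 h2 h3 w
    have e : Q x w = B w • chartField Y p x + C w • chartField Z p x := rfl
    rw [e, map_add, map_smul, map_smul, hx.2, hx.2, h1, h2, smul_zero, zero_add, smul_eq_mul,
      abs_mul, abs_mul, ← mul_assoc, mul_comm |C w|, mul_assoc (|κ p| + 1)]
    exact mul_le_mul_of_nonneg_right
      (mul_le_mul h3.le (C.le_opNorm w) (abs_nonneg _) (by positivity)) (abs_nonneg _)

end Coordinates

/-! ### Conclusions in the unsteady and the steady case -/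

namespace AlmostParacontactMetric

variable {M : Type*} [TopologicalSpace M] [ChartedSpace (Model 3) M] [IsManifold (𝓡 3) ∞ M]
  {S : AlmostParacontactMetric M}

section Unsteady

variable {c : ℝ}

theorem isKilling_of_ne_zero (hS : S.IsNormal) (hc0 : c ≠ 0) (hc : S.g.IsRicciSoliton S.xi c) :
    S.g.IsKilling S.xi := by
  intro p Y Z hY hZ
  obtain ⟨U, e, b₁, b₂, a₃, a₄, a₅, hp, h⟩ := S.exists_localDescription hS p
  have := hc p Y Z hY hZ
  rw [h.ricci_eq_of_ne_zero hc0 hc hp] at this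
  linarith

theorem hasConstantSectionalCurvature_of_ne_zero (hS : S.IsNormal) (hc0 : c ≠ 0)
    (hc : S.g.IsRicciSoliton S.xi c) : S.g.HasConstantSectionalCurvature (c / 2) := by
  intro p u v huv
  obtain ⟨U, e, b₁, b₂, a₃, a₄, a₅, hp, h⟩ := S.exists_localDescription hS p
  rw [PseudoMetric.sectional, h.curvatureAt_eq_of_ne_zero hc0 hc hp, div_eq_iff huv]
  simp only [map_smul, map_sub, smul_apply, sub_apply, smul_eq_mul, S.g.symm p v u]
  ring

theorem neg_of_ne_zero [Nonempty M] (hS : S.IsNormal) (hc0 : c ≠ 0)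
    (hc : S.g.IsRicciSoliton S.xi c) : c / 2 < 0 := by
  obtain ⟨p⟩ := ‹Nonempty M›
  obtain ⟨U, e, b₁, b₂, a₃, a₄, a₅, hp, h⟩ := S.exists_localDescription hS p
  have := h.b₂_sq hc0 hc hp
  have h2 : c / 2 ≠ 0 := by simpa using hc0
  exact lt_of_le_of_ne (by nlinarith [sq_nonneg (b₂ p)]) h2

end Unsteady

namespace IsLocalDescription

open Filter Topology

variable {U : Set M} {e : VField 3 M} {b₁ b₂ a₃ a₄ a₅ : M → ℝ}

/-- For a steady soliton, `b₁ = b₂` or `b₁ = -b₂` near every point. -/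
theorem eventually_eq_or_eq_neg (h : S.IsLocalDescription U e b₁ b₂ a₃ a₄ a₅)
    (hc : S.g.IsRicciSoliton S.xi 0) {p : M} (hp : p ∈ U) :
    (∀ᶠ q in 𝓝 p, b₁ q + b₂ q = 0) ∨ ∀ᶠ q in 𝓝 p, b₁ q - b₂ q = 0 := by
  have hE := h.isFrame
  have hU := h.isOpen.mem_nhds hp
  have s1 := h.near_of_contMDiffOn h.smooth_b₁ hp
  have s2 := h.near_of_contMDiffOn h.smooth_b₂ hp
  have he : SmoothFieldAt e p := (hE.near hp 1).at
  have hf : SmoothFieldAt (S.phiField e) p := (hE.near hp 2).at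
  -- The vectors e ± φe are null with g(e + φe, e − φe) = 2, so each one, halved, is the g-dual of
  -- the other; this gives the coefficient functionals α and β.
  refine eventually_eq_zero_or_of_dirDeriv (X := fun q => e q - S.phiField e q)
    (Y := fun q => e q + S.phiField e q) (Z := S.xi) (κ := fun q => -2 * b₁ q)
    (α := (1 / 2 : ℝ) • S.g.val p (e p + S.phi p (e p)))
    (β := (1 / 2 : ℝ) • S.g.val p (e p - S.phi p (e p))) (ζ := S.g.val p (S.xi p))
    (he.sub hf) (he.add hf) (S.smoothFieldNear_xi p).at ?_ (s1.add s2) (s1.sub s2) ?_ ?_ ?_ ?_ ?_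
  · intro w
    have h1 := hE.expand hp w
    rw [Fin.sum_univ_three] at h1
    simp only [frame, frameSign, Matrix.cons_val, phiField] at h1
    conv_rhs => rw [h1]
    simp only [smul_apply, smul_eq_mul, map_add, map_sub, add_apply, sub_apply, phiField,
      S.g.symm p w]
    module
  · filter_upwards [hU, s1, s2] with q hq t1 t2
    rw [dirDeriv_add t1 t2, dirDeriv_vsub, dirDeriv_vsub, h.e_b₁ hc hq, h.e_b₂ hc hq]
    simp only [phiField]
    ring
  · filter_upwards [hU, s1, s2] with q hq t1 t2
    rw [dirDeriv_sub t1 t2, dirDeriv_vadd, dirDeriv_vadd, h.e_b₁ hc hq, h.e_b₂ hc hq]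
    simp only [phiField]
    ring
  · filter_upwards [hU, s1, s2] with q hq t1 t2
    rw [dirDeriv_sub t1 t2]
    linear_combination h.xi_b₁_add hc hq - (h.jacobiEquations q hq).1
  · exact continuousAt_const.mul s1.at.continuousAt
  · filter_upwards [hU] with q hq
    linear_combination h.sq_sub_sq hc hq

/-- Substitution of b₂ = εb₁ into e(b₁) = φe(b₂); the relation must hold near q because it is
differentiated. -/
theorem dirDeriv_of_steady (h : S.IsLocalDescription U e b₁ b₂ a₃ a₄ a₅)
    (hc : S.g.IsRicciSoliton S.xi 0) {q : M} (hq : q ∈ U) {ε : ℝ}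
    (hb : b₂ =ᶠ[𝓝 q] fun x => ε * b₁ x) :
    dirDeriv b₁ q (e q - ε • S.phi q (e q)) = 0 := by
  have s1 := h.near_of_contMDiffOn h.smooth_b₁ hq
  have h1 := h.e_b₁ hc hq
  rw [dirDeriv_congr hb, dirDeriv_mul contMDiffAt_const s1.at, dirDeriv_const] at h1
  rw [dirDeriv_vsub, dirDeriv_vsmul, h1]
  ring

theorem exists_steady (h : S.IsLocalDescription U e b₁ b₂ a₃ a₄ a₅)
    (hc : S.g.IsRicciSoliton S.xi 0) {p : M} (hp : p ∈ U) :
    ∃ V : Set M, IsOpen V ∧ p ∈ V ∧ V ⊆ U ∧ ∃ ε : ℝ, (ε = 1 ∨ ε = -1) ∧ ∀ q ∈ V,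
      b₂ q = ε * b₁ q ∧ dirDeriv b₁ q (S.xi q) = -2 * b₁ q ^ 2 ∧
      S.g.scalar q = -4 * b₁ q ∧ dirDeriv b₁ q (e q - ε • S.phi q (e q)) = 0 := by
  obtain ⟨ε, hε, hb⟩ : ∃ ε : ℝ, (ε = 1 ∨ ε = -1) ∧ ∀ᶠ q in 𝓝 p, b₂ q = ε * b₁ q := by
    rcases h.eventually_eq_or_eq_neg hc hp with h1 | h1
    · exact ⟨-1, Or.inr rfl, h1.mono fun q hq => by linarith⟩
    · exact ⟨1, Or.inl rfl, h1.mono fun q hq => by linarith⟩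
  obtain ⟨V, hV, hVo, hpV⟩ := eventually_nhds_iff.1 (hb.and (h.isOpen.mem_nhds hp))
  refine ⟨V, hVo, hpV, fun q hq => (hV q hq).2, ε, hε, fun q hq => ?_⟩
  obtain ⟨hbq, hqU⟩ := hV q hq
  refine ⟨hbq, ?_, ?_, h.dirDeriv_of_steady hc hqU ?_⟩
  · linear_combination h.xi_b₁_add hc hqU
  · linear_combination h.scalar_eq hc hqU
  · filter_upwards [hVo.mem_nhds hq] with x hx using (hV x hx).1

end IsLocalDescription

end AlmostParacontactMetric

end Paracontact

theorem mainTheorem5 {M : Type*} [TopologicalSpace M] [T2Space M] [SecondCountableTopology M]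
    [ConnectedSpace M] [ChartedSpace (Model 3) M] [IsManifold (𝓡 3) ∞ M]
    (S : AlmostParacontactMetric M) (hS : S.IsNormal)
    (c : ℝ) (hc : S.g.IsRicciSoliton S.xi c) :
    (∀ p : M, ∃ (U : Set M) (e : VField 3 M) (b₁ b₂ a₃ a₄ a₅ : M → ℝ),
      p ∈ U ∧ S.IsLocalDescription U e b₁ b₂ a₃ a₄ a₅) ∧
    (∀ (U : Set M) (e : VField 3 M) (b₁ b₂ a₃ a₄ a₅ : M → ℝ),
      S.IsLocalDescription U e b₁ b₂ a₃ a₄ a₅ →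
        S.JacobiEquations U e b₁ b₂ a₃ a₄ a₅ ∧
        ∀ p ∈ U, dirDeriv b₁ p (S.xi p) + 2 * b₁ p ^ 2 = 0) ∧
    (c ≠ 0 →
      S.g.IsKilling S.xi ∧
      ∃ k : ℝ, k < 0 ∧ S.g.HasConstantSectionalCurvature k ∧
        ∀ (U : Set M) (e : VField 3 M) (b₁ b₂ a₃ a₄ a₅ : M → ℝ),
          S.IsLocalDescription U e b₁ b₂ a₃ a₄ a₅ → ∀ p ∈ U, k = -b₂ p ^ 2) ∧
    (c = 0 →
      ∀ (U : Set M) (e : VField 3 M) (b₁ b₂ a₃ a₄ a₅ : M → ℝ),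
        S.IsLocalDescription U e b₁ b₂ a₃ a₄ a₅ →
          ∀ p ∈ U, ∃ V : Set M, IsOpen V ∧ p ∈ V ∧ V ⊆ U ∧
            ∃ ε : ℝ, (ε = 1 ∨ ε = -1) ∧
              ∀ q ∈ V,
                b₂ q = ε * b₁ q ∧
                dirDeriv b₁ q (S.xi q) = -2 * b₁ q ^ 2 ∧
                S.g.scalar q = -4 * b₁ q ∧
                dirDeriv b₁ q (e q - ε • S.phi q (e q)) = 0) := by
  refine ⟨S.exists_localDescription hS,
    fun U e b₁ b₂ a₃ a₄ a₅ h => ⟨h.jacobiEquations, fun p hp => h.xi_b₁_add hc hp⟩,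
    fun hc0 => ⟨S.isKilling_of_ne_zero hS hc0 hc, c / 2, S.neg_of_ne_zero hS hc0 hc,
      S.hasConstantSectionalCurvature_of_ne_zero hS hc0 hc,
      fun U e b₁ b₂ a₃ a₄ a₅ h p hp => by rw [h.b₂_sq hc0 hc hp, neg_neg]⟩, ?_⟩
  rintro rfl U e b₁ b₂ a₃ a₄ a₅ h p hp
  exact h.exists_steady hc hp
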